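/- For integers $A,B$ with $AB(A-B)\neq 0$ let $E^{A,B}$ be the elliptic curve $y^2=x(x+A)(x+B)$ over $\mathbb{Q}$, let $\widehat{E}^{A,B}: Y^2=X^3-2(A+B)X^2+(A-B)^2X$, let $\phi:E^{A,B}\to\widehat{E}^{A,B}$ be the $2$-isogeny $\phi(x,y)=\left(\frac{y^2}{x^2},\,-\frac{y(x^2-AB)}{x^2}\right)$ with kernel $\{O,(0,0)\}$, and let $\widehat{\phi}:\widehat{E}^{A,B}\to E^{A,B}$ be the dual isogeny. For an isogeny $\psi:E\to E'$ over $\mathbb{Q}$ let $\mathrm{Sel}^{(\psi)}(E/\mathbb{Q})=\ker\big(H^1(\mathbb{Q},E[\psi])\to\prod_v H^1(\mathbb{Q}_v,E)\big)$, the product running over all places $v$ of $\mathbb{Q}$ (including the real one). Theorem. Let $A,B$ be integers with $A\equiv 1 \pmod 8$ and $B\equiv 3\pmod 8$, and assume that $$\mathrm{Sel}^{(\phi)}(E^{A,B}/\mathbb{Q})\simeq\{0\},\qquad \mathrm{Sel}^{(\widehat{\phi})}(\widehat{E}^{A,B}/\mathbb{Q})\simeq(\mathbb{Z}/2\mathbb{Z})^2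 .$$ Then for every prime number $r$ coprime to $AB(A-B)$ such that (i) $r\equiv 7\pmod 8$, and (ii) for every odd prime $p$ dividing $AB(A-B)$ the Legendre symbol satisfies $\left(\frac{r}{p}\right)=1$, the quadratic twist $E^{A,B}_r: y^2=x^3+(A+B)r\,x^2+ABr^2\,x$ has Mordell–Weil rank $0$ over $\mathbb{Q}$. -/

import Mathlib

open WeierstrassCurve

noncomputable section

namespace TwoDescent

/-! ### The curves -/

/-- The curve `E^{A,B} : y² = x (x + A) (x + B) = x³ + (A + B) x² + A B x`. -/
def curve (K : Type*) [Field K] (A B : ℤ) : WeierstrassCurve K where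
  a₁ := 0
  a₂ := A + B
  a₃ := 0
  a₄ := A * B
  a₆ := 0

/-- The 2-isogenous curve `Y² = X³ - 2 (A + B) X² + (A - B)² X`. -/
def dualCurve (K : Type*) [Field K] (A B : ℤ) : WeierstrassCurve K where
  a₁ := 0
  a₂ := -2 * (A + B)
  a₃ := 0
  a₄ := (A - B) ^ 2
  a₆ := 0

/-- The `d`-th quadratic twist `y² = x³ + a d x² + b d² x + c d³` of a curve
`y² = x³ + a x² + b x + c`. -/
def quadraticTwist {K : Type*} [Field K] (W : WeierstrassCurve K) (d : ℤ) : WeierstrassCurve K where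
  a₁ := 0
  a₂ := W.a₂ * d
  a₃ := 0
  a₄ := W.a₄ * d ^ 2
  a₆ := W.a₆ * d ^ 3

/-! ### The isogeny `φ : E^{A,B} → Ê^{A,B}` and its dual -/

/-- On a curve with `a₁ = a₃ = 0` the point `(0, 0)`, if it is a nonsingular point, has order 2, so
it generates a subgroup consisting of itself and the point at infinity. -/
lemma kernel_closed {F : Type*} [Field F] [DecidableEq F] {W : Affine F}
    (h₁ : W.a₁ = 0) (h₃ : W.a₃ = 0)
    {P Q : W.Point} (hP : P = 0 ∨ ∃ h, P = .some 0 0 h) (hQ : Q = 0 ∨ ∃ h, Q = .some 0 0 h) :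
    (P + Q = 0 ∨ P + Q = P ∨ P + Q = Q) ∧ -P = P := by
  have key : ∀ h, (Affine.Point.some 0 0 h : W.Point) + .some 0 0 h = 0 := fun h =>
    Affine.Point.add_of_Y_eq rfl (by simp [Affine.negY, h₁, h₃])
  rcases hP with rfl | ⟨h, rfl⟩ <;> rcases hQ with rfl | ⟨h', rfl⟩
  · simp
  · simp
  · simp [h₃]
  · simp [key, h₃]

section Isogeny

variable {K : Type*} [Field K] [CharZero K] {F : Type*} [Field F] [Algebra K F]

lemma nonsingular_curve_iff (A B : ℤ) (x y : F) :
    ((curve K A B)⁄F).toAffine.Nonsingular x y ↔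
      y ^ 2 = x ^ 3 + (A + B) * x ^ 2 + A * B * x ∧
        (3 * x ^ 2 + 2 * (A + B) * x + A * B ≠ 0 ∨ y ≠ 0) := by
  have : CharZero F := charZero_of_injective_algebraMap (algebraMap K F).injective
  rw [Affine.nonsingular_iff', Affine.equation_iff]
  simp [curve]
  grind

lemma nonsingular_dualCurve_iff (A B : ℤ) (x y : F) :
    ((dualCurve K A B)⁄F).toAffine.Nonsingular x y ↔
      y ^ 2 = x ^ 3 - 2 * (A + B) * x ^ 2 + (A - B) ^ 2 * x ∧
        (3 * x ^ 2 - 4 * (A + B) * x + (A - B) ^ 2 ≠ 0 ∨ y ≠ 0) := by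
  have : CharZero F := charZero_of_injective_algebraMap (algebraMap K F).injective
  rw [Affine.nonsingular_iff', Affine.equation_iff]
  simp [dualCurve, map_ofNat]
  grind

lemma nonsingular_isog {A B : ℤ} {x y : F} (h : ((curve K A B)⁄F).toAffine.Nonsingular x y)
    (hx : x ≠ 0) :
    ((dualCurve K A B)⁄F).toAffine.Nonsingular (y ^ 2 / x ^ 2)
      (-y * (x ^ 2 - A * B) / x ^ 2) := by
  have : CharZero F := charZero_of_injective_algebraMap (algebraMap K F).injective
  rw [nonsingular_curve_iff (K := K)] at h
  rw [nonsingular_dualCurve_iff (K := K)]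
  obtain ⟨h, hn⟩ := h
  have hX : y ^ 2 / x ^ 2 = (x ^ 2 + (A + B) * x + A * B) / x := by
    rw [h]; field_simp
  refine ⟨?_, ?_⟩
  · rw [hX, div_pow, mul_pow, neg_sq, h]; field_simp; ring
  · by_contra! hc
    obtain ⟨hc₁, hc₂⟩ := hc
    have hy : y = 0 ∨ x ^ 2 - A * B = 0 := by simpa [hx] using hc₂
    have hy0 : y = 0 := by
      rcases hy with hy | hy
      · exact hy
      · have hq : (A * B : F) = x ^ 2 := (sub_eq_zero.mp hy).symm
        have hX' : y ^ 2 / x ^ 2 = 2 * x + (A + B) := by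
          rw [hX, hq]; field_simp; ring
        have hd : ((A : F) - B) ^ 2 = (A + B) ^ 2 - 4 * x ^ 2 := by rw [← hq]; ring
        rw [hX', hd] at hc₁
        have h0 : 2 * x + (A + B : F) = 0 := by
          have : 4 * x * (2 * x + (A + B : F)) = 0 := by linear_combination hc₁
          simpa [hx] using this
        rw [h0] at hX'
        simpa [hx] using hX'
    subst hy0
    have hd : (A : F) = B := by
      have : ((A : F) - B) ^ 2 = 0 := by simpa using hc₁
      exact sub_eq_zero.mp (pow_eq_zero_iff (two_ne_zero) |>.mp this)
    have hxA : x + B = 0 := by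
      have : x * (x + B) ^ 2 = 0 := by rw [hd] at h; linear_combination -h
      simpa [hx] using this
    refine hn.elim (fun h' => h' ?_) (fun h' => h' rfl)
    rw [hd, eq_neg_of_add_eq_zero_left hxA]; ring

lemma nonsingular_dualIsog {A B : ℤ} {x y : F}
    (h : ((dualCurve K A B)⁄F).toAffine.Nonsingular x y) (hx : x ≠ 0) :
    ((curve K A B)⁄F).toAffine.Nonsingular (y ^ 2 / (4 * x ^ 2))
      (y * ((A - B) ^ 2 - x ^ 2) / (8 * x ^ 2)) := by
  have : CharZero F := charZero_of_injective_algebraMap (algebraMap K F).injective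
  rw [nonsingular_dualCurve_iff (K := K)] at h
  rw [nonsingular_curve_iff (K := K)]
  obtain ⟨h, hn⟩ := h
  have hX : y ^ 2 / (4 * x ^ 2) = (x ^ 2 - 2 * (A + B) * x + (A - B) ^ 2) / (4 * x) := by
    rw [h]; field_simp
  refine ⟨?_, ?_⟩
  · rw [hX, div_pow, mul_pow, h]; field_simp; ring
  · by_contra! hc
    obtain ⟨hc₁, hc₂⟩ := hc
    have hy : y = 0 ∨ (A - B : F) ^ 2 - x ^ 2 = 0 := by simpa [hx] using hc₂
    have hy0 : y = 0 := by
      rcases hy with hy | hy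
      · exact hy
      · have hq : (A - B : F) ^ 2 = x ^ 2 := sub_eq_zero.mp hy
        have hX' : y ^ 2 / (4 * x ^ 2) = (x - (A + B)) / 2 := by
          rw [hX, hq]; field_simp; ring
        rw [hX'] at hc₁
        have h0 : x - (A + B : F) = 0 := by
          have : x * (x - (A + B : F)) = 0 := by
            linear_combination 2 * hc₁ + (1 / 2) * hq
          simpa [hx] using this
        rw [h0] at hX'
        simpa [hx] using hX'
    subst hy0
    have hq : (A * B : F) = 0 := by simpa using hc₁
    have hxA : x - (A + B) = 0 := by
      have : x * (x - (A + B)) ^ 2 = 0 := by linear_combination -h + 4 * x * hq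
      simpa [hx] using this
    refine hn.elim (fun h' => h' ?_) (fun h' => h' rfl)
    rw [sub_eq_zero.mp hxA]; linear_combination -4 * hq

open scoped Classical in
/-- The 2-isogeny `φ(x, y) = (y² / x², -y (x² - A B) / x²)` on `F`-points; the point at infinity
and the point `(0, 0)` are sent to the point at infinity. -/
def isog (A B : ℤ) : ((curve K A B)⁄F).toAffine.Point → ((dualCurve K A B)⁄F).toAffine.Point
  | .zero => 0
  | .some _ _ h => if hx : _ = 0 then 0 else .some _ _ (nonsingular_isog h hx)

open scoped Classical in
/-- The dual isogeny `φ̂(X, Y) = (Y² / (4 X²), Y ((A - B)² - X²) / (8 X²))` on `F`-points; the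
point at infinity and the point `(0, 0)` are sent to the point at infinity. -/
def dualIsog (A B : ℤ) : ((dualCurve K A B)⁄F).toAffine.Point → ((curve K A B)⁄F).toAffine.Point
  | .zero => 0
  | .some _ _ h => if hx : _ = 0 then 0 else .some _ _ (nonsingular_dualIsog h hx)

lemma isog_eq_zero {A B : ℤ} {P : ((curve K A B)⁄F).toAffine.Point} (h : isog A B P = 0) :
    P = 0 ∨ ∃ h, P = .some 0 0 h := by
  have : CharZero F := charZero_of_injective_algebraMap (algebraMap K F).injective
  rcases P with _ | ⟨x, y, hP⟩
  · exact Or.inl rfl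
  · by_cases hx : x = 0
    · subst hx
      have hy : y = 0 := by simpa using ((nonsingular_curve_iff (K := K) A B 0 y).mp hP).1
      subst hy
      exact Or.inr ⟨hP, rfl⟩
    · simp [isog, hx] at h

lemma dualIsog_eq_zero {A B : ℤ} {P : ((dualCurve K A B)⁄F).toAffine.Point}
    (h : dualIsog A B P = 0) : P = 0 ∨ ∃ h, P = .some 0 0 h := by
  have : CharZero F := charZero_of_injective_algebraMap (algebraMap K F).injective
  rcases P with _ | ⟨x, y, hP⟩
  · exact Or.inl rfl
  · by_cases hx : x = 0
    · subst hx
      have hy : y = 0 := by simpa using ((nonsingular_dualCurve_iff (K := K) A B 0 y).mp hP).1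
      subst hy
      exact Or.inr ⟨hP, rfl⟩
    · simp [dualIsog, hx] at h

variable (K F) in
/-- The kernel `E^{A,B}[φ]` in the group of `F`-points. -/
def isogKer [DecidableEq F] (A B : ℤ) : AddSubgroup ((curve K A B)⁄F).toAffine.Point where
  carrier := {P | isog A B P = 0}
  zero_mem' := rfl
  add_mem' {P Q} hP hQ := by
    rcases (kernel_closed (by simp [curve]) (by simp [curve]) (isog_eq_zero hP)
      (isog_eq_zero hQ)).1 with h | h | h
    · rw [h]; rfl
    · rwa [h]
    · rwa [h]
  neg_mem' {P} hP := by
    rwa [(kernel_closed (by simp [curve]) (by simp [curve]) (isog_eq_zero hP)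
      (isog_eq_zero hP)).2]

variable (K F) in
/-- The kernel `Ê^{A,B}[φ̂]` in the group of `F`-points. -/
def dualIsogKer [DecidableEq F] (A B : ℤ) : AddSubgroup ((dualCurve K A B)⁄F).toAffine.Point where
  carrier := {P | dualIsog A B P = 0}
  zero_mem' := rfl
  add_mem' {P Q} hP hQ := by
    rcases (kernel_closed (by simp [dualCurve]) (by simp [dualCurve]) (dualIsog_eq_zero hP)
      (dualIsog_eq_zero hQ)).1 with h | h | h
    · rw [h]; rfl
    · rwa [h]
    · rwa [h]
  neg_mem' {P} hP := by
    rwa [(kernel_closed (by simp [dualCurve]) (by simp [dualCurve]) (dualIsog_eq_zero hP)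
      (dualIsog_eq_zero hP)).2]

end Isogeny

/-! ### Galois cohomology and Selmer groups -/

section Selmer

open scoped Classical

variable {K : Type} [Field K]

variable (K) in
/-- The absolute Galois group of `K` (used in characteristic zero), with the Krull topology. -/
abbrev Gal : Type := AlgebraicClosure K ≃ₐ[K] AlgebraicClosure K

/-- The group `W(K̄)`. -/
abbrev GeomPoint (W : WeierstrassCurve K) : Type := (W⁄(AlgebraicClosure K)).toAffine.Point

/-- The action of an automorphism of `K̄` on `W(K̄)`, coordinate by coordinate. -/
def galAct (W : WeierstrassCurve K) (σ : Gal K) : GeomPoint W →+ GeomPoint W :=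
  Affine.Point.map (W' := W) σ.toAlgHom

/-- The continuous 1-cocycles of the absolute Galois group of `K` with values in the discrete
module `M ⊆ W(K̄)`: locally constant `c` with `c (σ τ) = c σ + σ (c τ)`. -/
def cocycles (W : WeierstrassCurve K) (M : AddSubgroup (GeomPoint W)) :
    AddSubgroup (Gal K → GeomPoint W) where
  carrier := {c | IsLocallyConstant c ∧ (∀ σ, c σ ∈ M) ∧
    ∀ σ τ, c (σ * τ) = c σ + galAct W σ (c τ)}
  zero_mem' := ⟨IsLocallyConstant.const 0, fun _ => M.zero_mem, by simp⟩
  add_mem' {c c'} h h' := ⟨h.1.add h'.1, fun σ => M.add_mem (h.2.1 σ) (h'.2.1 σ), fun σ τ => by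
    simp only [Pi.add_apply, h.2.2 σ τ, h'.2.2 σ τ, map_add]; abel⟩
  neg_mem' {c} h := ⟨h.1.neg, fun σ => M.neg_mem (h.2.1 σ), fun σ τ => by
    simp only [Pi.neg_apply, h.2.2 σ τ, map_neg]; abel⟩

/-- The 1-coboundaries `σ ↦ σ P - P` with `P ∈ M`. -/
def coboundaries (W : WeierstrassCurve K) (M : AddSubgroup (GeomPoint W)) :
    AddSubgroup (cocycles W M) where
  carrier := {c | ∃ P ∈ M, ∀ σ, c.1 σ = galAct W σ P - P}
  zero_mem' := ⟨0, M.zero_mem, by simp⟩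
  add_mem' := by
    rintro c c' ⟨P, hP, h⟩ ⟨P', hP', h'⟩
    refine ⟨P + P', M.add_mem hP hP', fun σ => ?_⟩
    simp only [AddSubgroup.coe_add, Pi.add_apply, h, h', map_add]; abel
  neg_mem' := by
    rintro c ⟨P, hP, h⟩
    refine ⟨-P, M.neg_mem hP, fun σ => ?_⟩
    simp only [AddSubgroup.coe_neg, Pi.neg_apply, h, map_neg]; abel

/-- The continuous cohomology group `H¹(K, M)`. -/
abbrev H1 (W : WeierstrassCurve K) (M : AddSubgroup (GeomPoint W)) : Type :=
  cocycles W M ⧸ coboundaries W M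

/-- `c` becomes trivial in `H¹(L, W(L̄))`, where `L` is an extension of `K`: for each embedding `ι`
of `K̄` into `L̄` there is `P ∈ W(L̄)` with `ι (c σ) = τ P - P` for all `τ` in the absolute Galois
group of `L`, where `σ` is the restriction of `τ` to `K̄` along `ι`. (The condition on the class
of `c` does not depend on `ι`.) -/
def LocallyTrivial (W : WeierstrassCurve K) (L : Type) [Field L] [Algebra K L]
    (c : Gal K → GeomPoint W) : Prop :=
  ∀ ι : AlgebraicClosure K →ₐ[K] AlgebraicClosure L, ∃ P : (W⁄(AlgebraicClosure L)).toAffine.Point,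
    ∀ (τ : AlgebraicClosure L ≃ₐ[L] AlgebraicClosure L) (σ : Gal K),
      (∀ x, ι (σ x) = τ (ι x)) →
        Affine.Point.map (W' := W) ι (c σ) = Affine.Point.map (W' := W) τ.toAlgHom P - P

/-- The 1-cocycles with values in `M` whose classes become trivial in `H¹(ℚ_v, W)` at every place
`v` of `ℚ`, that is, at every prime number and at the real place. -/
def selmerCocycles (W : WeierstrassCurve ℚ) (M : AddSubgroup (GeomPoint W)) :
    AddSubgroup (cocycles W M) where
  carrier := {c | LocallyTrivial W ℝ c.1 ∧
    ∀ (p : ℕ) [Fact p.Prime], LocallyTrivial W ℚ_[p] c.1}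
  zero_mem' := by
    refine ⟨fun ι => ⟨0, ?_⟩, fun p _ ι => ⟨0, ?_⟩⟩ <;> simp
  add_mem' := by
    have key : ∀ (L : Type) [Field L] [Algebra ℚ L] (c c' : Gal ℚ → GeomPoint W),
        LocallyTrivial W L c → LocallyTrivial W L c' → LocallyTrivial W L (c + c') := by
      intro L _ _ c c' h h' ι
      obtain ⟨P, hP⟩ := h ι
      obtain ⟨P', hP'⟩ := h' ι
      refine ⟨P + P', fun τ σ hσ => ?_⟩
      simp only [Pi.add_apply, map_add, hP τ σ hσ, hP' τ σ hσ]; abel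
    rintro c c' ⟨h, h2⟩ ⟨h', h2'⟩
    exact ⟨key _ _ _ h h', fun p _ => key _ _ _ (h2 p) (h2' p)⟩
  neg_mem' := by
    have key : ∀ (L : Type) [Field L] [Algebra ℚ L] (c : Gal ℚ → GeomPoint W),
        LocallyTrivial W L c → LocallyTrivial W L (-c) := by
      intro L _ _ c h ι
      obtain ⟨P, hP⟩ := h ι
      refine ⟨-P, fun τ σ hσ => ?_⟩
      simp only [Pi.neg_apply, map_neg, hP τ σ hσ]; abel
    rintro c ⟨h, h2⟩
    exact ⟨key _ _ h, fun p _ => key _ _ (h2 p)⟩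

/-- For `M` the kernel of an isogeny `ψ` defined on `W`, the Selmer group
`Sel^{(ψ)}(W/ℚ) = ker (H¹(ℚ, W[ψ]) → ∏_v H¹(ℚ_v, W))`. -/
def selmer (W : WeierstrassCurve ℚ) (M : AddSubgroup (GeomPoint W)) : AddSubgroup (H1 W M) :=
  (selmerCocycles W M).map (QuotientAddGroup.mk' (coboundaries W M))

variable (K) in
/-- The Galois module `E^{A,B}[φ] ⊆ E^{A,B}(K̄)`. -/
def phiTorsion [CharZero K] (A B : ℤ) : AddSubgroup (GeomPoint (curve K A B)) :=
  isogKer K (AlgebraicClosure K) A B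

variable (K) in
/-- The Galois module `Ê^{A,B}[φ̂] ⊆ Ê^{A,B}(K̄)`. -/
def phiHatTorsion [CharZero K] (A B : ℤ) : AddSubgroup (GeomPoint (dualCurve K A B)) :=
  dualIsogKer K (AlgebraicClosure K) A B

/-- The Selmer group `Sel^{(φ)}(E^{A,B}/ℚ)`. -/
def selmerPhi (A B : ℤ) : AddSubgroup (H1 (curve ℚ A B) (phiTorsion ℚ A B)) :=
  selmer (curve ℚ A B) (phiTorsion ℚ A B)

/-- The Selmer group `Sel^{(φ̂)}(Ê^{A,B}/ℚ)`. -/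
def selmerPhiHat (A B : ℤ) : AddSubgroup (H1 (dualCurve ℚ A B) (phiHatTorsion ℚ A B)) :=
  selmer (dualCurve ℚ A B) (phiHatTorsion ℚ A B)

end Selmer

end TwoDescent

end

open WeierstrassCurve

noncomputable section

namespace TwoDescent

/-! ### Squares in finite fields -/

/-! The proof is a descent through the 2-isogeny on the twist `y² = x (x + A r) (x + B r)`, with the
twisted Selmer conditions compared to the given ones. Let `d` be the squarefree part of a nonzero
`x`-coordinate on the twist or on its isogenous curve. Over the reals and over `ℚ_p` for odd `p ∣ A
B (A - B)`, `r` is a square, so the twist is isomorphic to the original curve and `d` satisfies the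
original local condition. At odd primes of good reduction the condition is automatic for `p ∤ d`.
Only `r` and `2` remain.

On the isogenous side, `r ∤ d` because `A B` is a nonresidue mod `r`, and the torsor equation read
mod `r` gives `(d/r) = 1`. Reciprocity, with `r ≡ 7 mod 8` and `(r/p) = 1`, turns this into `d ≡ 1
mod 4` once a 2-adic obstruction has excluded even `d`. The local conditions at `r` and `2` follow,
so `d` represents a class of the trivial group `Sel^{(φ)}` and is a square
(`isSquare_of_dualCurve_twist_point`).

On the curve itself, `Sel^{(φ̂)}` has order 4, hence consists of the classes `1, A B, -A, -B` of the
2-torsion. Translating a point by 2-torsion makes `d` a unit with `(d/r) = 1`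
(`AdmissibleTwist.exists_add_two_torsion`). The symbol at `r` then excludes `A B` and `-A`, and a
congruence mod 8 on the torsor excludes `-B`, so `x` is a square (`isSquare_of_curve_twist_point`).

Both facts together give `P + T = 2 Q` with `2 T = 0` (`IsTwoTorsionModel.exists_eq_two_nsmul`),
hence `2 P = 2 (2 Q)` for every `P` that is not itself 2-torsion, while for 2-torsion `Q = 0` will
do. Iterating yields an infinite chain of halvings. Heights stay bounded along it, so `2 P` is
torsion (`IsTwoTorsionModel.isOfFinAddOrder_of_chain`) and the rank is 0; finite generation is not
needed. -/

lemma isSquare_mul_of_not_isSquare {F : Type*} [Field F] [Finite F] {a b : F}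
    (ha : ¬ IsSquare a) (hb : ¬ IsSquare b) : IsSquare (a * b) := by
  classical
  have := Fintype.ofFinite F
  have ha0 : a ≠ 0 := by rintro rfl; exact ha ⟨0, by simp⟩
  have hb0 : b ≠ 0 := by rintro rfl; exact hb ⟨0, by simp⟩
  rw [← quadraticChar_one_iff_isSquare (mul_ne_zero ha0 hb0), map_mul,
    quadraticChar_neg_one_iff_not_isSquare.mpr ha, quadraticChar_neg_one_iff_not_isSquare.mpr hb]
  norm_num

/-- A counting argument in place of a Hasse bound. The quadratic factor at `X = s` is the
discriminant of `(x + u) (x + v) = s x`. If the claim failed, it would be a nonzero square for each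
nonsquare `s`, so each `s` would have two preimages under `x ↦ (x + u) (x + v) / x`, all different
from `0` and `-u`. That is more room than the field offers, since at least half of its nonzero
elements are nonsquares. -/
lemma exists_nonsquare_on_curve {F : Type*} [Field F] [Finite F] (h2 : (2 : F) ≠ 0) {u v : F}
    (hu : u ≠ 0) (hv : v ≠ 0) {g : F} (hg : ¬ IsSquare g) :
    ∃ X : F, ¬ IsSquare X ∧ IsSquare (X * (X ^ 2 - 2 * (u + v) * X + (u - v) ^ 2)) := by
  classical
  have := Fintype.ofFinite F
  by_contra! hcon
  have hsq : ∀ s : F, ¬ IsSquare s →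
      ∃ δ : F, δ ≠ 0 ∧ s ^ 2 - 2 * (u + v) * s + (u - v) ^ 2 = δ ^ 2 := by
    intro s hs
    have h := hcon s hs
    have h' : IsSquare (s ^ 2 - 2 * (u + v) * s + (u - v) ^ 2) := by
      by_contra h''
      exact h (isSquare_mul_of_not_isSquare hs h'')
    obtain ⟨δ, hδ⟩ := h'
    refine ⟨δ, ?_, by rw [hδ, sq]⟩
    rintro rfl
    exact h ⟨0, by rw [hδ]; ring⟩
  choose! δ hδ0 hδ using hsq
  have hg0 : g ≠ 0 := by rintro rfl; exact hg ⟨0, by simp⟩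
  -- the two preimages of a nonsquare under `x ↦ (x + u) * (x + v) / x`
  let f : {s : F // ¬ IsSquare s} × Bool → {x : F // x ≠ 0 ∧ x ≠ -u} := fun p =>
    ⟨(p.1.1 - u - v + (if p.2 then δ p.1.1 else -δ p.1.1)) / 2, by
      have key : ∀ e : F, e ^ 2 = p.1.1 ^ 2 - 2 * (u + v) * p.1.1 + (u - v) ^ 2 →
          (p.1.1 - u - v + e) / 2 ≠ 0 ∧ (p.1.1 - u - v + e) / 2 ≠ -u := by
        intro e he
        have hp0 : p.1.1 ≠ 0 := by
          intro h; exact p.1.2 (h ▸ ⟨0, by simp⟩)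
        constructor
        · intro h
          have h1 : p.1.1 - u - v + e = 0 := by simpa [h2] using h
          have : 2 * 2 * (u * v) = 0 := by
            linear_combination (he - (e - (p.1.1 - u - v)) * h1)
          simp [h2, hu, hv] at this
        · intro h
          have h1 : p.1.1 - u - v + e = -u * 2 := by rwa [div_eq_iff h2] at h
          have : 2 * 2 * (u * p.1.1) = 0 := by
            linear_combination (he - (e - u - p.1.1 + v) * h1)
          simp [h2, hu, hp0] at this
      split_ifs
      · exact key _ (hδ _ p.1.2).symm
      · exact key _ (by rw [neg_sq]; exact (hδ _ p.1.2).symm)⟩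
  have hf : Function.Injective f := by
    rintro ⟨⟨s, hs⟩, i⟩ ⟨⟨t, ht⟩, j⟩ h
    have hS : ∀ (s : F), ¬ IsSquare s → ∀ (i : Bool) (x : F),
        x = (s - u - v + (if i then δ s else -δ s)) / 2 →
          s * x = (x + u) * (x + v) := by
      intro s hs i x hx
      have hd := hδ s hs
      have hx' : 2 * x - (s - u - v) = if i then δ s else -δ s := by
        rw [hx]; field_simp; ring
      have hx2 : (2 * x - (s - u - v)) ^ 2 = δ s ^ 2 := by
        rw [hx']; split_ifs <;> ring
      have : 2 * 2 * ((x + u) * (x + v) - s * x) = 0 := by linear_combination hx2 - hd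
      have : (x + u) * (x + v) - s * x = 0 := by simpa [h2] using this
      linear_combination -this
    have hval := congrArg Subtype.val h
    have hx0 := (f (⟨s, hs⟩, i)).2.1
    have e1 := hS s hs i _ rfl
    have e2 := hS t ht j _ hval
    have hst : s = t := mul_right_cancel₀ hx0 (e1.trans e2.symm)
    subst hst
    have hd0 := hδ0 s hs
    simp only [f] at hval
    have : i = j := by
      have hne : δ s ≠ - δ s := by
        intro h'
        have : 2 * δ s = 0 := by linear_combination h'
        simp [h2, hd0] at this
      rcases i <;> rcases j <;> simp [h2, sub_eq_add_neg] at hval ⊢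
      · exact hne hval.symm
      · exact hne hval
    rw [this]
  have c1 := Fintype.card_le_of_injective f hf
  -- nonsquares are at least as many as nonzero squares
  let m : {x : F // x ≠ 0} → {s : F // ¬ IsSquare s} × Bool := fun x =>
    if h : IsSquare x.1 then (⟨g * x.1, fun h' => hg (by
      have := h'.div h; rwa [mul_div_assoc, div_self x.2, mul_one] at this)⟩, true)
    else (⟨x.1, h⟩, false)
  have hm : Function.Injective m := by
    rintro ⟨x, hx⟩ ⟨y, hy⟩ h
    simp only [m] at h
    split_ifs at h
    · simp [hg0] at h; exact Subtype.ext h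
    · simp at h
    · simp at h
    · simp at h; exact Subtype.ext h
  have c2 := Fintype.card_le_of_injective m hm
  -- Removing `-u` makes the inequality strict, which is what contradicts the two cardinality
  -- bounds.
  have c3 : Fintype.card {x : F // x ≠ 0 ∧ x ≠ -u} < Fintype.card {x : F // x ≠ 0} := by
    refine Fintype.card_lt_of_injective_of_notMem
      (fun x : {x : F // x ≠ 0 ∧ x ≠ -u} => (⟨x.1, x.2.1⟩ : {x : F // x ≠ 0}))
      (fun x y h => Subtype.ext (by simpa using h)) (b := ⟨-u, by simpa using hu⟩) ?_
    rintro ⟨x, hx⟩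
    exact x.2.2 (by simpa using hx)
  omega

/-! ### Squares in `ℚ_p` -/

lemma norm_lt_one_iff_toZMod_eq_zero {p : ℕ} [Fact p.Prime] (x : ℤ_[p]) :
    ‖x‖ < 1 ↔ PadicInt.toZMod x = 0 := by
  rw [← RingHom.mem_ker, PadicInt.ker_toZMod, IsLocalRing.mem_maximalIdeal, PadicInt.mem_nonunits]

lemma two_ne_zero_zmod {p : ℕ} [Fact p.Prime] (hp : p ≠ 2) : (2 : ZMod p) ≠ 0 := by
  have h20 : ((2 : ℕ) : ZMod p) ≠ 0 := by
    rw [Ne, ZMod.natCast_eq_zero_iff]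
    intro hd
    exact hp ((Nat.prime_dvd_prime_iff_eq Fact.out Nat.prime_two).mp hd)
  exact_mod_cast h20

lemma exists_sq_eq_of_toZMod {p : ℕ} [Fact p.Prime] (hp : p ≠ 2) {u w : ℤ_[p]}
    (hu : PadicInt.toZMod u ≠ 0) (h : PadicInt.toZMod w ^ 2 = PadicInt.toZMod u) :
    ∃ z : ℤ_[p], z ^ 2 = u ∧ PadicInt.toZMod z = PadicInt.toZMod w := by
  have h1 : ‖w ^ 2 - u‖ < 1 := by
    rw [norm_lt_one_iff_toZMod_eq_zero]; simp [h]
  have h2 : ‖(2 * w : ℤ_[p])‖ = 1 := by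
    refine le_antisymm (PadicInt.norm_le_one _) (not_lt.mp fun hlt => ?_)
    rw [norm_lt_one_iff_toZMod_eq_zero, map_mul, map_ofNat, mul_eq_zero] at hlt
    rcases hlt with hlt | hlt
    · exact two_ne_zero_zmod hp hlt
    · rw [hlt] at h; exact hu (by rw [← h]; simp)
  obtain ⟨z, hz, hz', -⟩ := hensels_lemma (p := p) (R := ℤ_[p])
    (F := Polynomial.X ^ 2 - Polynomial.C u) (a := w) (by simpa [h2, one_add_one_eq_two] using h1)
  refine ⟨z, ?_, ?_⟩
  · simpa [sub_eq_zero] using hz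
  · have : ‖z - w‖ < 1 := by simpa [h2, one_add_one_eq_two] using hz'
    rw [norm_lt_one_iff_toZMod_eq_zero] at this
    simpa [sub_eq_zero] using this

lemma isSquare_padic_of_zmod {p : ℕ} [Fact p.Prime] (hp : p ≠ 2) {n : ℤ} (hn : ¬ (p : ℤ) ∣ n)
    (h : IsSquare (n : ZMod p)) : IsSquare (n : ℚ_[p]) := by
  obtain ⟨w, hw⟩ := h
  obtain ⟨w', rfl⟩ := ZMod.ringHom_surjective (PadicInt.toZMod (p := p)) w
  obtain ⟨z, hz, -⟩ := exists_sq_eq_of_toZMod hp (u := (n : ℤ_[p])) (w := w')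
    (by rwa [map_intCast, Ne, ZMod.intCast_zmod_eq_zero_iff_dvd]) (by rw [map_intCast, hw, sq])
  exact ⟨z, by rw [← sq]; exact_mod_cast congrArg (fun x : ℤ_[p] => (x : ℚ_[p])) hz.symm⟩

lemma isSquare_padic_two {n : ℤ} (hn : n ≡ 1 [ZMOD 8]) : IsSquare (n : ℚ_[2]) := by
  -- Hensel's lemma at the approximate root 1 of `X² - n` needs precision beyond `‖2‖² = 1/4`;
  -- divisibility by 8 provides `1/8`.
  have h1 : ‖(1 - n : ℤ_[2])‖ < ‖(2 : ℤ_[2])‖ ^ 2 := by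
    obtain ⟨k, hk⟩ := hn.dvd
    have : (1 - n : ℤ_[2]) = (2 : ℕ) ^ 3 * k := by
      have := congrArg (fun x : ℤ => (x : ℤ_[2])) hk
      push_cast at this ⊢
      rw [this]; norm_num
    have h2 : ‖((2 : ℕ) : ℤ_[2])‖ = ((2 : ℕ) : ℝ)⁻¹ := PadicInt.norm_p
    have h2' : ‖(2 : ℤ_[2])‖ = 2⁻¹ := by exact_mod_cast h2
    rw [this, norm_mul, norm_pow, h2, h2']
    have := PadicInt.norm_le_one (k : ℤ_[2])
    norm_num
    nlinarith [norm_nonneg (k : ℤ_[2])]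
  obtain ⟨z, hz, -⟩ := hensels_lemma (p := 2) (R := ℤ_[2])
    (F := Polynomial.X ^ 2 - Polynomial.C (n : ℤ_[2])) (a := 1)
    (by simpa [one_add_one_eq_two] using h1)
  have hz : z ^ 2 = n := by simpa [sub_eq_zero] using hz
  exact ⟨z, by rw [← sq]; exact_mod_cast congrArg (fun x : ℤ_[2] => (x : ℚ_[2])) hz.symm⟩

/-! ### Quadratic reciprocity -/

lemma jacobiSym_eq_one_of_forall_prime {r : ℤ} :
    ∀ {n : ℕ}, n ≠ 0 → (∀ p : ℕ, [Fact p.Prime] → p ∣ n → legendreSym p r = 1) →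
      jacobiSym r n = 1 := by
  intro n
  induction n using Nat.recOnMul with
  | zero => simp
  | one => simp
  | prime p hp =>
    intro _ h
    have : Fact p.Prime := ⟨hp⟩
    rw [← jacobiSym.legendreSym.to_jacobiSym]
    exact h p dvd_rfl
  | mul a b ha hb =>
    intro h0 h
    have ha0 : a ≠ 0 := by rintro rfl; simp at h0
    have hb0 : b ≠ 0 := by rintro rfl; simp at h0
    rw [jacobiSym.mul_right' _ ha0 hb0,
      ha ha0 fun p _ hp => h p (hp.mul_right b), hb hb0 fun p _ hp => h p (hp.mul_left a), one_mul]

/-- Every prime factor of `z` has `r` as a residue, so the Jacobi symbol of `r` over `|z|` is 1.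
Reciprocity flips it exactly when `|z| ≡ 3 mod 4`, and a negative sign contributes `(-1/r) = -1`;
the two effects combine into a dependence on `z mod 4` alone. -/
lemma legendreSym_eq_of_emod_four {r : ℕ} [Fact r.Prime] (hr4 : r % 4 = 3) {z : ℤ}
    (h : ∀ p : ℕ, [Fact p.Prime] → (p : ℤ) ∣ z → legendreSym p (r : ℤ) = 1) :
    (z % 4 = 1 → legendreSym r z = 1) ∧ (z % 4 = 3 → legendreSym r z = -1) := by
  have hj : z ≠ 0 → jacobiSym r z.natAbs = 1 := fun hz =>
    jacobiSym_eq_one_of_forall_prime (Int.natAbs_ne_zero.mpr hz)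
      fun p _ hp => h p (Int.natCast_dvd.mpr hp)
  simp only [jacobiSym.legendreSym.to_jacobiSym]
  rcases Int.natAbs_eq z with hz | hz
  · constructor <;> intro h4 <;> specialize hj (by omega) <;> rw [hz]
    · rw [jacobiSym.quadratic_reciprocity_one_mod_four (by omega) (Nat.odd_iff.mpr (by omega)), hj]
    · rw [jacobiSym.quadratic_reciprocity_three_mod_four (by omega) (by omega), hj]
  · constructor <;> intro h4 <;> specialize hj (by omega) <;> rw [hz,
      jacobiSym.neg _ (Nat.odd_iff.mpr (by omega)), ZMod.χ₄_nat_three_mod_four hr4]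
    · rw [jacobiSym.quadratic_reciprocity_three_mod_four (by omega) (by omega), hj]; norm_num
    · rw [jacobiSym.quadratic_reciprocity_one_mod_four (by omega) (Nat.odd_iff.mpr (by omega)), hj]; norm_num

/-! ### Curves `y² = x³ + a x² + b x` and their point `(0, 0)` -/

/-- `W` is an elliptic curve of the shape `y² = x³ + a x² + b x`. -/
structure IsTwoTorsionModel {K : Type*} [Field K] (W : WeierstrassCurve K) : Prop where
  a₁ : W.a₁ = 0
  a₃ : W.a₃ = 0
  a₆ : W.a₆ = 0
  a₄ : W.a₄ ≠ 0
  disc : W.a₂ ^ 2 - 4 * W.a₄ ≠ 0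

section Points

variable {K : Type*} [Field K] {W : WeierstrassCurve K}

lemma IsTwoTorsionModel.baseChange (hW : IsTwoTorsionModel W) (F : Type*) [Field F] [Algebra K F] :
    IsTwoTorsionModel (W⁄F) where
  a₁ := by simp [hW.a₁]
  a₃ := by simp [hW.a₃]
  a₆ := by simp [hW.a₆]
  a₄ := by simpa using hW.a₄
  disc := by
    have h := (map_ne_zero (algebraMap K F)).mpr hW.disc
    simpa [map_ofNat] using h

lemma IsTwoTorsionModel.equation_iff (hW : IsTwoTorsionModel W) (x y : K) :
    W.toAffine.Equation x y ↔ y ^ 2 = x ^ 3 + W.a₂ * x ^ 2 + W.a₄ * x := by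
  rw [Affine.equation_iff]; simp [hW.a₁, hW.a₃, hW.a₆]

lemma IsTwoTorsionModel.nonsingular_iff [CharZero K] (hW : IsTwoTorsionModel W) (x y : K) :
    W.toAffine.Nonsingular x y ↔ y ^ 2 = x ^ 3 + W.a₂ * x ^ 2 + W.a₄ * x := by
  rw [← hW.equation_iff, ← Affine.equation_iff_nonsingular_of_Δ_ne_zero]
  have : W.Δ = 16 * W.a₄ ^ 2 * (W.a₂ ^ 2 - 4 * W.a₄) := by
    simp [WeierstrassCurve.Δ, b₂, b₄, b₆, b₈, hW.a₁, hW.a₃, hW.a₆]; ring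
  rw [this]
  exact mul_ne_zero (mul_ne_zero (by norm_num) (pow_ne_zero _ hW.a₄)) hW.disc

lemma IsTwoTorsionModel.nonsingular_zero [CharZero K] (hW : IsTwoTorsionModel W) :
    W.toAffine.Nonsingular 0 0 := by
  rw [hW.nonsingular_iff]; simp

variable [DecidableEq K]

lemma IsTwoTorsionModel.zero_add_some [CharZero K] (hW : IsTwoTorsionModel W) {x y : K}
    (h : W.toAffine.Nonsingular x y) (hx : x ≠ 0) :
    ∃ h', (Affine.Point.some 0 0 hW.nonsingular_zero : W.toAffine.Point) + .some x y h =
      .some (W.a₄ / x) (-W.a₄ * y / x ^ 2) h' := by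
  have he := (hW.nonsingular_iff x y).mp h
  have hX : W.toAffine.addX 0 x (W.toAffine.slope 0 x 0 y) = W.a₄ / x := by
    rw [Affine.slope_of_X_ne hx.symm]
    simp [Affine.addX, hW.a₁]
    field_simp
    linear_combination he
  have hY : W.toAffine.addY 0 x 0 (W.toAffine.slope 0 x 0 y) = -W.a₄ * y / x ^ 2 := by
    rw [Affine.addY, Affine.negAddY, hX, Affine.slope_of_X_ne hx.symm]
    simp [Affine.negY, hW.a₁, hW.a₃]
    field_simp
  have h0 := Affine.Point.add_of_X_ne (h₁ := hW.nonsingular_zero) (h₂ := h) hx.symm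
  refine ⟨?_, ?_⟩
  · rw [← hX, ← hY]; exact Affine.nonsingular_add hW.nonsingular_zero h (by simp [hx.symm])
  · rw [h0]; simp only [hX, hY]

lemma IsTwoTorsionModel.add_self (hW : IsTwoTorsionModel W) {x : K}
    (h : W.toAffine.Nonsingular x 0) :
    (Affine.Point.some x 0 h : W.toAffine.Point) + .some x 0 h = 0 :=
  Affine.Point.add_of_Y_eq rfl (by simp [Affine.negY, hW.a₁, hW.a₃])

end Points

/-! ### Kummer cocycles -/

section Kummer

open scoped Classical

variable {K : Type} [Field K] {W : WeierstrassCurve K}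

lemma gal_apply_eq_or_eq_neg {s : AlgebraicClosure K} {d : K}
    (hs : s ^ 2 = algebraMap K _ d) (σ : Gal K) : σ s = s ∨ σ s = -s := by
  rw [← sq_eq_sq_iff_eq_or_eq_neg, ← map_pow, hs, AlgEquiv.commutes]

variable [CharZero K]

/-- The point `(0, 0)` of `W(K̄)`. -/
def geomTwoTorsion (hW : IsTwoTorsionModel W) : GeomPoint W :=
  .some 0 0 (hW.baseChange _).nonsingular_zero

lemma geomTwoTorsion_ne_zero (hW : IsTwoTorsionModel W) : geomTwoTorsion hW ≠ 0 :=
  Affine.Point.some_ne_zero _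

lemma geomTwoTorsion_add_self (hW : IsTwoTorsionModel W) :
    geomTwoTorsion hW + geomTwoTorsion hW = 0 :=
  (hW.baseChange _).add_self _

lemma galAct_geomTwoTorsion (hW : IsTwoTorsionModel W) (σ : Gal K) :
    galAct W σ (geomTwoTorsion hW) = geomTwoTorsion hW := by
  unfold galAct geomTwoTorsion
  rw [Affine.Point.map_some]
  simp

/-- The quadratic character of `K(s) / K`, `s² ∈ K`, with values in `{O, (0, 0)}`. -/
def kummerMap (hW : IsTwoTorsionModel W) (s : AlgebraicClosure K) (σ : Gal K) : GeomPoint W :=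
  if σ s = s then 0 else geomTwoTorsion hW

lemma kummerMap_mem_cocycles (hW : IsTwoTorsionModel W) {s : AlgebraicClosure K} {d : K}
    (hs : s ^ 2 = algebraMap K _ d) {M : AddSubgroup (GeomPoint W)} (hM : geomTwoTorsion hW ∈ M) :
    kummerMap hW s ∈ cocycles W M := by
  refine ⟨?_, ?_, ?_⟩
  · rw [IsLocallyConstant.iff_exists_open]
    intro σ
    refine ⟨(fun τ => σ⁻¹ * τ) ⁻¹' (MulAction.stabilizer (Gal K) s : Set (Gal K)),
      (stabilizer_isOpen_of_isIntegral s).preimage (continuous_const_mul _), by simp, ?_⟩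
    intro τ hτ
    have : τ s = σ s := by
      have h : (σ⁻¹ * τ) s = s := hτ
      calc τ s = σ ((σ⁻¹ * τ) s) := by
            rw [← AlgEquiv.mul_apply, mul_inv_cancel_left]
        _ = σ s := by rw [h]
    simp only [kummerMap, this]
  · intro σ
    unfold kummerMap
    split_ifs
    exacts [M.zero_mem, hM]
  · intro σ τ
    have hT := galAct_geomTwoTorsion hW σ
    have hTT := geomTwoTorsion_add_self hW
    by_cases hs0 : s = 0
    · simp [kummerMap, hs0]
    have hne : -s ≠ s := by
      intro h
      exact hs0 (by linear_combination (-1 / 2 : AlgebraicClosure K) * h)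
    rcases gal_apply_eq_or_eq_neg hs σ with h1 | h1 <;>
      rcases gal_apply_eq_or_eq_neg hs τ with h2 | h2 <;>
      simp [kummerMap, AlgEquiv.mul_apply, h1, h2, hne, hT, hTT]

/-- A condition on `d ∈ L` that implies that it lies in the image of the isogenous curve
`Y² = X³ - 2 a X² + (a² - 4 b) X` under `(X, Y) ↦ X`, `(0, 0) ↦ a² - 4 b`. -/
def LocallySolvable {L : Type*} [Field L] (a b d : L) : Prop :=
  IsSquare d ∨ (∃ X Y : L, X ≠ 0 ∧ IsSquare (d * X) ∧
    Y ^ 2 = X * (X ^ 2 - 2 * a * X + (a ^ 2 - 4 * b))) ∨ IsSquare (d * (a ^ 2 - 4 * b))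

/-- The hypothesis says that `τ P` is `P` or `P + (0, 0)` according to whether `τ` fixes `√d`, i.e.
that the Kummer cocycle is `τ ↦ τ P - P`. The coordinates are those of translation by `(0, 0)`. -/
lemma locallyTrivial_of_point (hW : IsTwoTorsionModel W) {s : AlgebraicClosure K} {L : Type}
    [Field L] [Algebra K L] [CharZero L]
    (h : ∀ ι : AlgebraicClosure K →ₐ[K] AlgebraicClosure L, ∃ x y : AlgebraicClosure L,
      x ≠ 0 ∧ y ^ 2 = x ^ 3 + algebraMap K _ W.a₂ * x ^ 2 + algebraMap K _ W.a₄ * x ∧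
      ∀ τ : AlgebraicClosure L ≃ₐ[L] AlgebraicClosure L,
        (τ (ι s) = ι s → τ x = x ∧ τ y = y) ∧
        (τ (ι s) ≠ ι s → τ x = algebraMap K _ W.a₄ / x ∧
          τ y = - algebraMap K _ W.a₄ * y / x ^ 2)) :
    LocallyTrivial W L (kummerMap hW s) := by
  intro ι
  obtain ⟨x, y, hx, hxy, hτ⟩ := h ι
  have hF := hW.baseChange (AlgebraicClosure L)
  have hP : (W⁄(AlgebraicClosure L)).toAffine.Nonsingular x y := by
    rw [hF.nonsingular_iff]; exact hxy
  refine ⟨.some x y hP, fun τ σ hσ => ?_⟩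
  obtain ⟨h1, h2⟩ := hτ τ
  have hiff : σ s = s ↔ τ (ι s) = ι s := by
    rw [← hσ]; exact ι.injective.eq_iff.symm
  rw [Affine.Point.map_some]
  unfold kummerMap
  split_ifs with hc
  · obtain ⟨e1, e2⟩ := h1 (hiff.mp hc)
    rw [map_zero, eq_comm, sub_eq_zero]
    simp [e1, e2]
  · obtain ⟨e1, e2⟩ := h2 (fun h' => hc (hiff.mpr h'))
    obtain ⟨h', h3⟩ := hF.zero_add_some hP hx
    rw [eq_sub_iff_add_eq]
    have : Affine.Point.map (W' := W) ι (geomTwoTorsion hW) = .some 0 0 hF.nonsingular_zero := by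
      unfold geomTwoTorsion
      rw [Affine.Point.map_some]
      simp
    rw [this, h3]
    simp [e1, e2]

/-- The trivializing point is a preimage, under the isogeny with kernel `{O, (0, 0)}`, of the
`L`-point provided by `LocallySolvable`; the three alternatives correspond to `O`, a point with `X ≠
0`, and `(0, 0)`. -/
lemma locallyTrivial_of_locallySolvable (hW : IsTwoTorsionModel W) {s : AlgebraicClosure K} {d : K}
    (hs : s ^ 2 = algebraMap K _ d) (hd : d ≠ 0) {L : Type} [Field L] [Algebra K L] [CharZero L]
    (h : LocallySolvable (algebraMap K L W.a₂) (algebraMap K L W.a₄) (algebraMap K L d)) :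
    LocallyTrivial W L (kummerMap hW s) := by
  have hιs : ∀ ι : AlgebraicClosure K →ₐ[K] AlgebraicClosure L,
      ι s ^ 2 = algebraMap L _ (algebraMap K L d) := by
    intro ι
    rw [← map_pow, hs, AlgHom.commutes, ← IsScalarTower.algebraMap_apply]
  have hdL : algebraMap L (AlgebraicClosure L) (algebraMap K L d) ≠ 0 := by
    simpa using hd
  rcases h with ⟨e, he⟩ | ⟨X, Y, hX, ⟨t, ht⟩, hY⟩ | ⟨t, ht⟩
  · intro ι
    refine ⟨0, fun τ σ hσ => ?_⟩
    have h1 : ι s ^ 2 = (algebraMap L _ e) ^ 2 := by rw [hιs, he, map_mul, sq]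
    have h2 : τ (ι s) = ι s := by
      rcases sq_eq_sq_iff_eq_or_eq_neg.mp h1 with h1 | h1 <;> simp [h1]
    have h3 : σ s = s := ι.injective ((hσ s).trans h2)
    simp [kummerMap, h3]
  · refine locallyTrivial_of_point hW fun ι => ?_
    set S := ι s
    have hS := hιs ι
    have hS0 : S ≠ 0 := by
      intro h; apply hdL; rw [← hS]; change S ^ 2 = 0; rw [h]; simp
    -- Since `t² = d X`, this `u` is a square root of `X` that changes sign with `√d`. The preimage
    -- is `x = (u² - a + Y/u) / 2`, `y = u x`; the substitution `u ↦ -u` exchanges `x` with `b / x`.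
    set u := algebraMap L _ t / S with hu
    have hu2 : u ^ 2 = algebraMap L _ X := by
      rw [hu, div_pow, hS, div_eq_iff hdL, ← map_mul, ← map_pow, mul_comm, ht, sq]
    have hX0 : algebraMap L (AlgebraicClosure L) X ≠ 0 := by simpa using hX
    have hu0 : u ≠ 0 := by intro h; apply hX0; rw [← hu2, h]; simp
    have hA : algebraMap K (AlgebraicClosure L) W.a₂ = algebraMap L _ (algebraMap K L W.a₂) :=
      IsScalarTower.algebraMap_apply ..
    have hB : algebraMap K (AlgebraicClosure L) W.a₄ = algebraMap L _ (algebraMap K L W.a₄) :=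
      IsScalarTower.algebraMap_apply ..
    have hB0 : algebraMap K (AlgebraicClosure L) W.a₄ ≠ 0 := by simpa using hW.a₄
    have hY' := congrArg (algebraMap L (AlgebraicClosure L)) hY
    simp only [map_mul, map_add, map_sub, map_pow, map_ofNat, ← hA, ← hB, ← hu2] at hY'
    set a := algebraMap K (AlgebraicClosure L) W.a₂
    set b := algebraMap K (AlgebraicClosure L) W.a₄
    set y := algebraMap L (AlgebraicClosure L) Y with hy
    have hx1 : ((u ^ 2 - a + y / u) / 2) * ((u ^ 2 - a - y / u) / 2) = b := by
      field_simp
      linear_combination -hY'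
    have hx0 : (u ^ 2 - a + y / u) / 2 ≠ 0 := by
      intro h; rw [h, zero_mul] at hx1; exact hB0 hx1.symm
    have hxq : u ^ 2 * ((u ^ 2 - a + y / u) / 2) =
        ((u ^ 2 - a + y / u) / 2) ^ 2 + a * ((u ^ 2 - a + y / u) / 2) + b := by
      rw [← hx1]; ring
    refine ⟨(u ^ 2 - a + y / u) / 2, u * ((u ^ 2 - a + y / u) / 2), hx0, ?_, fun τ => ⟨?_, ?_⟩⟩
    · linear_combination ((u ^ 2 - a + y / u) / 2) * hxq
    · intro hτ
      have hτu : τ u = u := by simp [hu, hτ]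
      have hτa : τ a = a := by rw [hA, AlgEquiv.commutes]
      simp [hτu, hτa, hy, map_ofNat]
    · intro hτ
      have hτS : τ S = -S := (gal_apply_eq_or_eq_neg hS τ).resolve_left hτ
      have hτu : τ u = -u := by simp [hu, hτS, div_neg]
      have hτa : τ a = a := by rw [hA, AlgEquiv.commutes]
      have h1 : τ ((u ^ 2 - a + y / u) / 2) = (u ^ 2 - a - y / u) / 2 := by
        simp [hτu, hτa, hy, div_neg, sub_eq_add_neg, map_ofNat]
      have h2 : (u ^ 2 - a - y / u) / 2 = b / ((u ^ 2 - a + y / u) / 2) := by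
        rw [eq_div_iff hx0, mul_comm, hx1]
      refine ⟨h1.trans h2, ?_⟩
      rw [map_mul, h1, hτu, h2]
      field_simp
  · refine locallyTrivial_of_point hW fun ι => ?_
    set S := ι s
    have hS := hιs ι
    have hS0 : S ≠ 0 := by
      intro h; apply hdL; rw [← hS]; change S ^ 2 = 0; rw [h]; simp
    -- Here `u² = a² - 4 b`, so the preimages of `(0, 0)` are the 2-torsion points with `x = (-a ±
    -- u) / 2`, which are exchanged when `√d` changes sign.
    set u := algebraMap L _ t / S with hu
    have hA : algebraMap K (AlgebraicClosure L) W.a₂ = algebraMap L _ (algebraMap K L W.a₂) :=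
      IsScalarTower.algebraMap_apply ..
    have hB : algebraMap K (AlgebraicClosure L) W.a₄ = algebraMap L _ (algebraMap K L W.a₄) :=
      IsScalarTower.algebraMap_apply ..
    have hu2 : u ^ 2 = algebraMap K (AlgebraicClosure L) W.a₂ ^ 2 -
        4 * algebraMap K (AlgebraicClosure L) W.a₄ := by
      have ht' := congrArg (algebraMap L (AlgebraicClosure L)) ht
      simp only [map_mul, map_sub, map_pow, map_ofNat] at ht'
      rw [hu, div_pow, hS, div_eq_iff hdL, hA, hB, sq (algebraMap L _ t), ← ht', mul_comm]
    have hB0 : algebraMap K (AlgebraicClosure L) W.a₄ ≠ 0 := by simpa using hW.a₄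
    set a := algebraMap K (AlgebraicClosure L) W.a₂
    set b := algebraMap K (AlgebraicClosure L) W.a₄
    have hx1 : ((-a + u) / 2) * ((-a - u) / 2) = b := by
      linear_combination (-1 / 4 : AlgebraicClosure L) * hu2
    have hx0 : (-a + u) / 2 ≠ 0 := by
      intro h; rw [h, zero_mul] at hx1; exact hB0 hx1.symm
    refine ⟨(-a + u) / 2, 0, hx0, ?_, fun τ => ⟨?_, ?_⟩⟩
    · linear_combination (-(-a + u) / 8) * hu2
    · intro hτ
      have hτu : τ u = u := by simp [hu, hτ]
      have hτa : τ a = a := by rw [hA, AlgEquiv.commutes]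
      simp [hτu, hτa, map_ofNat]
    · intro hτ
      have hτS : τ S = -S := (gal_apply_eq_or_eq_neg hS τ).resolve_left hτ
      have hτu : τ u = -u := by simp [hu, hτS, div_neg]
      have hτa : τ a = a := by rw [hA, AlgEquiv.commutes]
      have h1 : τ ((-a + u) / 2) = (-a - u) / 2 := by
        simp [hτu, hτa, sub_eq_add_neg, map_ofNat]
      have h2 : (-a - u) / 2 = b / ((-a + u) / 2) := by
        rw [eq_div_iff hx0, mul_comm, hx1]
      exact ⟨h1.trans h2, by simp⟩

/-- Equal quadratic characters mean that `s` and `s'` change sign together, so `s s'` is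
Galois-fixed and lies in `K`. -/
lemma isSquare_of_kummerMap_eq (hW : IsTwoTorsionModel W) {s s' : AlgebraicClosure K} {d d' : K}
    (hs : s ^ 2 = algebraMap K _ d) (hs' : s' ^ 2 = algebraMap K _ d')
    (h : kummerMap hW s = kummerMap hW s') : IsSquare (d * d') := by
  have : Algebra.IsSeparable K (AlgebraicClosure K) :=
    Algebra.IsAlgebraic.isSeparable_of_perfectField
  have : IsGalois K (AlgebraicClosure K) := ⟨⟩
  have hfix : s * s' ∈ (⊥ : IntermediateField K (AlgebraicClosure K)) := by
    rw [InfiniteGalois.mem_bot_iff_fixed]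
    intro σ
    have hσ := congrFun h σ
    have h0 := geomTwoTorsion_ne_zero hW
    unfold kummerMap at hσ
    split_ifs at hσ with h1 h2 h2
    · rw [map_mul, h1, h2]
    · exact absurd hσ h0.symm
    · exact absurd hσ h0
    · rw [map_mul, (gal_apply_eq_or_eq_neg hs σ).resolve_left h1,
        (gal_apply_eq_or_eq_neg hs' σ).resolve_left h2, neg_mul_neg]
  obtain ⟨e, he⟩ := IntermediateField.mem_bot.mp hfix
  refine ⟨e, (algebraMap K (AlgebraicClosure K)).injective ?_⟩
  rw [map_mul, map_mul, he, ← hs, ← hs']; ring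

/-- Galois acts trivially on `{O, (0, 0)}`, so all coboundaries vanish and cohomologous cocycles
coincide. -/
lemma eq_of_sub_mem_coboundaries (hW : IsTwoTorsionModel W) {M : AddSubgroup (GeomPoint W)}
    (hM : ∀ P ∈ M, P = 0 ∨ P = geomTwoTorsion hW) {c c' : cocycles W M}
    (h : (c : H1 W M) = c') : c = c' := by
  rw [QuotientAddGroup.eq] at h
  obtain ⟨P, hP, hc⟩ := h
  refine Subtype.ext (funext fun σ => ?_)
  have h0 : galAct W σ P = P := by
    rcases hM P hP with rfl | rfl
    · simp
    · exact galAct_geomTwoTorsion hW σ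
  have := hc σ
  rw [h0, sub_self] at this
  have h' : -(c.1 σ) + c'.1 σ = 0 := this
  exact (neg_add_eq_zero.mp h')

/-- The class of `d` in `H¹(K, M)`, for `(0, 0) ∈ M`. -/
def kummerClass (hW : IsTwoTorsionModel W) {M : AddSubgroup (GeomPoint W)}
    (hM : geomTwoTorsion hW ∈ M) (d : K) : H1 W M :=
  QuotientAddGroup.mk' (coboundaries W M)
    ⟨kummerMap hW (IsAlgClosed.exists_pow_nat_eq (algebraMap K (AlgebraicClosure K) d)
    two_pos).choose, kummerMap_mem_cocycles hW (IsAlgClosed.exists_pow_nat_eq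
      (algebraMap K (AlgebraicClosure K) d) two_pos).choose_spec hM⟩

lemma isSquare_of_kummerClass_eq (hW : IsTwoTorsionModel W) {M : AddSubgroup (GeomPoint W)}
    (hM : geomTwoTorsion hW ∈ M) (hM' : ∀ P ∈ M, P = 0 ∨ P = geomTwoTorsion hW) {d d' : K}
    (h : kummerClass hW hM d = kummerClass hW hM d') : IsSquare (d * d') :=
  isSquare_of_kummerMap_eq hW
    (IsAlgClosed.exists_pow_nat_eq (algebraMap K (AlgebraicClosure K) d) two_pos).choose_spec
    (IsAlgClosed.exists_pow_nat_eq (algebraMap K (AlgebraicClosure K) d') two_pos).choose_spec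
    (congrArg Subtype.val (eq_of_sub_mem_coboundaries hW hM' h))

end Kummer

/-! ### Selmer groups and rational square classes -/

section Selmer

open scoped Classical

variable {W : WeierstrassCurve ℚ} (hW : IsTwoTorsionModel W)
    {M : AddSubgroup (GeomPoint W)} (hM : geomTwoTorsion hW ∈ M)

/-- `d` satisfies the local condition for the curve `W` at every place of `ℚ`. -/
def EverywhereLocallySolvable (W : WeierstrassCurve ℚ) (d : ℚ) : Prop :=
  LocallySolvable (W.a₂ : ℝ) (W.a₄ : ℝ) (d : ℝ) ∧
    ∀ (p : ℕ) [Fact p.Prime], LocallySolvable (W.a₂ : ℚ_[p]) (W.a₄ : ℚ_[p]) (d : ℚ_[p])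

lemma kummerClass_mem_selmer {d : ℚ} (hd : d ≠ 0) (h : EverywhereLocallySolvable W d) :
    kummerClass hW hM d ∈ selmer W M := by
  refine ⟨_, ⟨?_, fun p _ => ?_⟩, rfl⟩
  · exact locallyTrivial_of_locallySolvable hW
      (IsAlgClosed.exists_pow_nat_eq (algebraMap ℚ (AlgebraicClosure ℚ) d) two_pos).choose_spec hd
      (by simpa using h.1)
  · exact locallyTrivial_of_locallySolvable hW
      (IsAlgClosed.exists_pow_nat_eq (algebraMap ℚ (AlgebraicClosure ℚ) d) two_pos).choose_spec hd
      (by simpa using h.2 p)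

lemma everywhereLocallySolvable_one : EverywhereLocallySolvable W 1 :=
  ⟨Or.inl (by simp), fun p _ => Or.inl (by simp)⟩

include hM

lemma isSquare_of_selmer_eq_bot (hM' : ∀ P ∈ M, P = 0 ∨ P = geomTwoTorsion hW)
    (hSel : selmer W M = ⊥) {d : ℚ} (hd : d ≠ 0) (h : EverywhereLocallySolvable W d) :
    IsSquare d := by
  have h1 := kummerClass_mem_selmer hW hM hd h
  have h2 := kummerClass_mem_selmer hW hM one_ne_zero everywhereLocallySolvable_one
  rw [hSel, AddSubgroup.mem_bot] at h1 h2
  simpa using isSquare_of_kummerClass_eq hW hM hM' (h1.trans h2.symm)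

/-- Representatives `f i` of `n` distinct classes exhaust a Selmer group of order `n`. This bypasses
surjectivity of the Kummer map onto `H¹`. -/
lemma exists_isSquare_mul_of_card_selmer (hM' : ∀ P ∈ M, P = 0 ∨ P = geomTwoTorsion hW)
    {n : ℕ} (hSel : Nat.card (selmer W M) = n) (hn : n ≠ 0) {f : Fin n → ℚ} (hf0 : ∀ i, f i ≠ 0)
    (hf : ∀ i, EverywhereLocallySolvable W (f i))
    (hinj : ∀ i j, IsSquare (f i * f j) → i = j) {d : ℚ} (hd : d ≠ 0)
    (h : EverywhereLocallySolvable W d) : ∃ i, IsSquare (f i * d) := by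
  have : Finite (selmer W M) := Nat.finite_of_card_ne_zero (hSel ▸ hn)
  have := Fintype.ofFinite (selmer W M)
  let g : Fin n → selmer W M := fun i => ⟨_, kummerClass_mem_selmer hW hM (hf0 i) (hf i)⟩
  have hg : Function.Injective g := fun i j hij =>
    hinj i j (isSquare_of_kummerClass_eq hW hM hM' (congrArg Subtype.val hij))
  have hb : Function.Bijective g := by
    rw [Fintype.bijective_iff_injective_and_card]
    exact ⟨hg, by rw [← Nat.card_eq_fintype_card, ← Nat.card_eq_fintype_card, hSel, Nat.card_fin]⟩
  obtain ⟨i, hi⟩ := hb.2 ⟨_, kummerClass_mem_selmer hW hM hd h⟩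
  exact ⟨i, isSquare_of_kummerClass_eq hW hM hM' (congrArg Subtype.val hi)⟩

end Selmer

/-! ### Consequences of the hypotheses on the Selmer groups -/

lemma isTwoTorsionModel_curve {K : Type*} [Field K] [CharZero K] {A B : ℤ}
    (h : A * B * (A - B) ≠ 0) : IsTwoTorsionModel (curve K A B) where
  a₁ := rfl
  a₃ := rfl
  a₆ := rfl
  a₄ := by
    have : A * B ≠ 0 := left_ne_zero_of_mul h
    simp only [curve]; exact_mod_cast this
  disc := by
    have : (A - B) ^ 2 ≠ 0 := pow_ne_zero _ (right_ne_zero_of_mul h)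
    have h' : ((A : K) - B) ^ 2 ≠ 0 := by exact_mod_cast this
    simp only [curve]
    intro h0; apply h'; rw [← h0]; ring

lemma isTwoTorsionModel_dualCurve {K : Type*} [Field K] [CharZero K] {A B : ℤ}
    (h : A * B * (A - B) ≠ 0) : IsTwoTorsionModel (dualCurve K A B) where
  a₁ := rfl
  a₃ := rfl
  a₆ := rfl
  a₄ := by
    have : (A - B) ^ 2 ≠ 0 := pow_ne_zero _ (right_ne_zero_of_mul h)
    simp only [dualCurve]; exact_mod_cast this
  disc := by
    have : 16 * (A * B) ≠ 0 := mul_ne_zero (by norm_num) (left_ne_zero_of_mul h)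
    have h' : 16 * ((A : K) * B) ≠ 0 := by exact_mod_cast this
    simp only [dualCurve]
    intro h0; apply h'; rw [← h0]; ring

lemma isSquare_of_selmerPhi_eq_bot {A B : ℤ} (h : A * B * (A - B) ≠ 0)
    (hSel : selmerPhi A B = ⊥) {d : ℚ} (hd : d ≠ 0)
    (hR : LocallySolvable (A + B : ℝ) (A * B : ℝ) (d : ℝ))
    (hp : ∀ (p : ℕ) [Fact p.Prime],
      LocallySolvable (A + B : ℚ_[p]) (A * B : ℚ_[p]) (d : ℚ_[p])) : IsSquare d := by
  refine isSquare_of_selmer_eq_bot (isTwoTorsionModel_curve h) (M := phiTorsion ℚ A B) ?_ ?_ hSel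
    hd ⟨by simpa [curve] using hR, fun p _ => by simpa [curve] using hp p⟩
  · change isog A B (.some 0 0 _) = 0
    simp [isog]
  · intro P hP
    rcases isog_eq_zero hP with h | ⟨_, h⟩
    exacts [Or.inl h, Or.inr h]

/-- The curve isogenous to `Ê` is `E` rescaled, through `(x, y) ↦ (4 x, 8 y)`, and its discriminant
term is `16 A B`. -/
lemma locallySolvable_dual {A B : ℤ} {L : Type*} [Field L] [CharZero L] {d : L}
    (h' : IsSquare d ∨ (∃ x y : L, x ≠ 0 ∧ IsSquare (d * x) ∧ y ^ 2 = x * (x + A) * (x + B)) ∨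
      IsSquare (d * (A * B))) :
    LocallySolvable (-2 * (A + B) : L) ((A - B) ^ 2 : L) d := by
  rcases h' with h' | ⟨x, y, hx, ⟨t, ht⟩, hy⟩ | ⟨t, ht⟩
  · exact Or.inl h'
  · refine Or.inr (Or.inl ⟨4 * x, 8 * y, mul_ne_zero (by norm_num) hx, ⟨2 * t, ?_⟩, ?_⟩)
    · linear_combination 4 * ht
    · linear_combination 64 * hy
  · exact Or.inr (Or.inr ⟨4 * t, by linear_combination 16 * ht⟩)

/-- The classes `1, A B, -A, -B` come from the rational points `O, (0, 0), (-A, 0), (-B, 0)` of `E`,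
so they are locally solvable everywhere. The nonsquare hypotheses make them distinct, and a Selmer
group of order 4 has no others. -/
lemma isSquare_mul_of_selmerPhiHat {A B : ℤ} (h : A * B * (A - B) ≠ 0)
    (hSel : Nonempty (selmerPhiHat A B ≃+ ZMod 2 × ZMod 2))
    (hA : ¬ IsSquare (-A : ℚ)) (hB : ¬ IsSquare (-B : ℚ)) (hAB : ¬ IsSquare (A * B : ℚ))
    {d : ℚ} (hd : d ≠ 0)
    (hR : LocallySolvable (-2 * (A + B) : ℝ) ((A - B) ^ 2 : ℝ) (d : ℝ))
    (hp : ∀ (p : ℕ) [Fact p.Prime],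
      LocallySolvable (-2 * (A + B) : ℚ_[p]) ((A - B) ^ 2 : ℚ_[p]) (d : ℚ_[p])) :
    IsSquare d ∨ IsSquare (A * B * d) ∨ IsSquare (-A * d) ∨ IsSquare (-B * d) := by
  have hA0 : (A : ℚ) ≠ 0 := by
    exact_mod_cast left_ne_zero_of_mul (left_ne_zero_of_mul h)
  have hB0 : (B : ℚ) ≠ 0 := by
    exact_mod_cast right_ne_zero_of_mul (left_ne_zero_of_mul h)
  have hglob : ∀ {d : ℚ},
      (∀ (L : Type) [Field L] [CharZero L], IsSquare (d : L) ∨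
        (∃ x y : L, x ≠ 0 ∧ IsSquare ((d : L) * x) ∧ y ^ 2 = x * (x + A) * (x + B)) ∨
        IsSquare ((d : L) * (A * B))) → EverywhereLocallySolvable (dualCurve ℚ A B) d := fun hL =>
    ⟨by simpa [dualCurve] using locallySolvable_dual (hL ℝ),
      fun p _ => by simpa [dualCurve] using locallySolvable_dual (hL ℚ_[p])⟩
  have sqA : ∀ {x : ℚ}, IsSquare (x * (A * A)) → IsSquare x := by
    rintro x hx
    have := hx.div (IsSquare.mul_self (A : ℚ))
    rwa [mul_div_assoc, div_self (mul_ne_zero hA0 hA0), mul_one] at this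
  have sqB : ∀ {x : ℚ}, IsSquare (x * (B * B)) → IsSquare x := by
    rintro x hx
    have := hx.div (IsSquare.mul_self (B : ℚ))
    rwa [mul_div_assoc, div_self (mul_ne_zero hB0 hB0), mul_one] at this
  obtain ⟨e⟩ := hSel
  have hcard : Nat.card (selmer (dualCurve ℚ A B) (phiHatTorsion ℚ A B)) = 4 :=
    (Nat.card_congr e.toEquiv).trans (by simp)
  obtain ⟨i, hi⟩ := exists_isSquare_mul_of_card_selmer (isTwoTorsionModel_dualCurve h)
    (M := phiHatTorsion ℚ A B) (f := ![1, A * B, -A, -B]) (d := d) (by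
      change dualIsog A B (.some 0 0 _) = 0
      simp [dualIsog]) (by
      intro P hP
      rcases dualIsog_eq_zero hP with h | ⟨_, h⟩
      exacts [Or.inl h, Or.inr h]) hcard four_ne_zero (by
      intro i
      fin_cases i
      exacts [one_ne_zero, mul_ne_zero hA0 hB0, neg_ne_zero.mpr hA0, neg_ne_zero.mpr hB0]) (by
      intro i
      fin_cases i <;> apply hglob <;> intro L _ _
      · exact Or.inl (by simp)
      · exact Or.inr (Or.inr ⟨A * B, by simp⟩)
      · exact Or.inr (Or.inl ⟨-A, 0, by simpa using hA0, ⟨A, by simp⟩, by ring⟩)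
      · exact Or.inr (Or.inl ⟨-B, 0, by simpa using hB0, ⟨B, by simp⟩, by ring⟩)) (by
      have n1 : ¬ IsSquare (A * B * -A : ℚ) := fun h' => hB (sqA (by convert h' using 1; ring))
      have n2 : ¬ IsSquare (A * B * -B : ℚ) := fun h' => hA (sqB (by convert h' using 1; ring))
      have n3 : ¬ IsSquare (-A * -B : ℚ) := by rwa [neg_mul_neg]
      have n1' := mul_comm (A * B : ℚ) (-A) ▸ n1
      have n2' := mul_comm (A * B : ℚ) (-B) ▸ n2
      have n3' := mul_comm (-A : ℚ) (-B) ▸ n3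
      intro i j hij
      by_contra hne
      revert hij
      fin_cases i <;> fin_cases j <;> first | exact absurd rfl hne | skip
      · simpa using hAB
      · simpa using hA
      · simpa using hB
      · simpa using hAB
      · exact n1
      · exact n2
      · simpa using hA
      · exact n1'
      · exact n3
      · simpa using hB
      · exact n2'
      · exact n3') hd
    ⟨by simpa [dualCurve] using hR, fun p _ => by simpa [dualCurve] using hp p⟩
  revert hi
  fin_cases i
  · exact fun hi => Or.inl (by simpa using hi)
  · exact fun hi => Or.inr (Or.inl hi)
  · exact fun hi => Or.inr (Or.inr (Or.inl hi))
  · exact fun hi => Or.inr (Or.inr (Or.inr hi))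

/-! ### Local solvability at primes of good reduction -/

section GoodReduction

variable {p : ℕ} [Fact p.Prime]

lemma isSquare_padic_of_toZMod (hp : p ≠ 2) {u : ℤ_[p]} (hu : PadicInt.toZMod u ≠ 0)
    (h : IsSquare (PadicInt.toZMod u)) : IsSquare (u : ℚ_[p]) := by
  obtain ⟨w, hw⟩ := h
  obtain ⟨w', rfl⟩ := ZMod.ringHom_surjective (PadicInt.toZMod (p := p)) w
  obtain ⟨z, hz, -⟩ := exists_sq_eq_of_toZMod hp hu (w := w') (by rw [hw, sq])
  exact ⟨z, by rw [← sq]; exact_mod_cast congrArg (fun x : ℤ_[p] => (x : ℚ_[p])) hz.symm⟩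

/-- Any lift `X` of a nonsquare `x` makes `d X` a product of two nonsquares mod `p`, hence a
`p`-adic square. It remains to lift `x` so that the cubic becomes a square. -/
lemma exists_padic_point_of_zmod (hp : p ≠ 2) {α β d : ℤ} (hD : ¬ (p : ℤ) ∣ α ^ 2 - 4 * β)
    (hd : ¬ IsSquare (d : ZMod p)) {x : ZMod p} (hx : ¬ IsSquare x)
    (h : IsSquare (x * (x ^ 2 + α * x + β))) :
    ∃ X Y : ℚ_[p], X ≠ 0 ∧ IsSquare (d * X) ∧ Y ^ 2 = X * (X ^ 2 + α * X + β) := by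
  have h2 := two_ne_zero_zmod hp
  have hx0 : x ≠ 0 := by rintro rfl; exact hx ⟨0, by simp⟩
  have hd0 : (d : ZMod p) ≠ 0 := by intro h; exact hd (h ▸ ⟨0, by simp⟩)
  have main : ∀ X : ℤ_[p], PadicInt.toZMod X = x → (X : ℚ_[p]) ≠ 0 ∧ IsSquare (d * X : ℚ_[p]) := by
    intro X hX
    constructor
    · intro h0
      have h0 : X = 0 := Subtype.ext h0
      rw [h0, map_zero] at hX
      exact hx0 hX.symm
    · have := isSquare_padic_of_toZMod hp (u := d * X) (by simp [hX, hd0, hx0])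
        (by simpa [hX] using isSquare_mul_of_not_isSquare hd hx)
      simpa using this
  -- If the cubic vanishes mod `p`, an arbitrary lift need not work. Then a true root is taken, from
  -- a square root of the discriminant (a unit by `hD`), and `Y = 0`. Otherwise the cubic is a unit
  -- that is a square mod `p`.
  by_cases h0 : x ^ 2 + α * x + β = 0
  · obtain ⟨w, hw⟩ := ZMod.ringHom_surjective (PadicInt.toZMod (p := p)) (2 * x + α)
    have hw2 : PadicInt.toZMod w ^ 2 = PadicInt.toZMod ((α ^ 2 - 4 * β : ℤ) : ℤ_[p]) := by
      rw [hw, map_intCast]; push_cast; linear_combination 4 * h0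
    obtain ⟨δ, hδ, hδw⟩ := exists_sq_eq_of_toZMod hp (w := w)
      (by rwa [map_intCast, Ne, ZMod.intCast_zmod_eq_zero_iff_dvd]) hw2
    have hu : IsUnit (2 : ℤ_[p]) := by
      rw [← IsLocalRing.notMem_maximalIdeal, ← PadicInt.ker_toZMod, RingHom.mem_ker, map_ofNat]
      exact h2
    obtain ⟨k, hk⟩ := hu.exists_right_inv
    have hk' : (2 : ZMod p) * PadicInt.toZMod k = 1 := by
      have := congrArg (PadicInt.toZMod (p := p)) hk
      simpa [map_ofNat] using this
    obtain ⟨h1, h3⟩ := main (k * (δ - α)) (by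
      rw [map_mul, map_sub, hδw, hw, map_intCast]; linear_combination x * hk')
    refine ⟨_, 0, h1, h3, ?_⟩
    have hδ' : (δ : ℚ_[p]) ^ 2 = α ^ 2 - 4 * β := by
      exact_mod_cast congrArg (fun x : ℤ_[p] => (x : ℚ_[p])) hδ
    have hkq : (k : ℚ_[p]) = 1 / 2 := by
      have : (2 : ℚ_[p]) * k = 1 := by
        exact_mod_cast congrArg (fun x : ℤ_[p] => (x : ℚ_[p])) hk
      field_simp; rw [mul_comm]; exact this
    push_cast
    rw [hkq]
    linear_combination (-((1 / 2 : ℚ_[p]) * (δ - α)) / 4) * hδ'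
  · obtain ⟨X, rfl⟩ := ZMod.ringHom_surjective (PadicInt.toZMod (p := p)) x
    obtain ⟨h1, h3⟩ := main X rfl
    obtain ⟨Y, hY⟩ := isSquare_padic_of_toZMod hp (u := X * (X ^ 2 + α * X + β))
      (by simpa using ⟨hx0, h0⟩) (by simpa using h)
    exact ⟨X, Y, h1, h3, by rw [sq, ← hY]; simp⟩

lemma locallySolvable_of_good (hp : p ≠ 2) {A B d : ℤ} (h : ¬ (p : ℤ) ∣ A * B * (A - B))
    (hd : ¬ (p : ℤ) ∣ d) :
    LocallySolvable (A + B : ℚ_[p]) (A * B : ℚ_[p]) (d : ℚ_[p]) := by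
  by_cases hds : IsSquare (d : ZMod p)
  · exact Or.inl (isSquare_padic_of_zmod hp hd hds)
  have hu : ((A * B * (A - B) : ℤ) : ZMod p) ≠ 0 := by
    rwa [Ne, ZMod.intCast_zmod_eq_zero_iff_dvd]
  push_cast at hu
  obtain ⟨x, hx, hx'⟩ := exists_nonsquare_on_curve (two_ne_zero_zmod hp)
    (left_ne_zero_of_mul (left_ne_zero_of_mul hu)) (right_ne_zero_of_mul (left_ne_zero_of_mul hu))
    hds
  obtain ⟨X, Y, hX, hdX, hY⟩ := exists_padic_point_of_zmod hp (α := -2 * (A + B))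
    (β := (A - B) ^ 2) (d := d) (by
      have h4 : (p : ℤ) ∣ (-2 * (A + B)) ^ 2 - 4 * (A - B) ^ 2 → (p : ℤ) ∣ 2 ^ 4 * (A * B) := by
        intro h; convert h using 1; ring
      intro h'
      rcases (Int.prime_iff_natAbs_prime.mpr (by simpa using (Fact.out : p.Prime))).dvd_or_dvd
        (h4 h') with h' | h'
      · have := (Nat.prime_iff_prime_int.mp (Fact.out : p.Prime)).dvd_of_dvd_pow h'
        exact hp ((Nat.prime_dvd_prime_iff_eq Fact.out Nat.prime_two).mp (by exact_mod_cast this))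
      · exact h (h'.mul_right _)) hds hx (by convert hx' using 2; push_cast; ring)
  refine Or.inr (Or.inl ⟨X, Y, hX, hdX, ?_⟩)
  rw [hY]; push_cast; ring

/-- For a nonsquare `d`, either `A B` is also a nonsquare mod `p` and `d A B` is a square, or `A B =
c²` and `x² + (A + B) x + A B` takes the shape `x² - 2 (u + v) x + (u - v)²` with `u, v = -(A + B)/4
± c/2`, to which `exists_nonsquare_on_curve` applies. -/
lemma locallySolvable_dual_of_good (hp : p ≠ 2) {A B d : ℤ} (h : ¬ (p : ℤ) ∣ A * B * (A - B))
    (hd : ¬ (p : ℤ) ∣ d) :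
    LocallySolvable (-2 * (A + B) : ℚ_[p]) ((A - B) ^ 2 : ℚ_[p]) (d : ℚ_[p]) := by
  apply locallySolvable_dual
  by_cases hds : IsSquare (d : ZMod p)
  · exact Or.inl (isSquare_padic_of_zmod hp hd hds)
  have hu : ((A * B * (A - B) : ℤ) : ZMod p) ≠ 0 := by
    rwa [Ne, ZMod.intCast_zmod_eq_zero_iff_dvd]
  push_cast at hu
  by_cases hAB : IsSquare ((A : ZMod p) * B)
  · obtain ⟨c, hc⟩ := hAB
    have h2 := two_ne_zero_zmod hp
    set s : ZMod p := -(A + B) / 2 / 2 with hs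
    have hs' : 2 * 2 * s = -(A + B) := by rw [hs]; field_simp
    have huv : 2 * 2 * 2 * 2 * ((s + c / 2) * (s - c / 2)) = (A - B : ZMod p) ^ 2 := by
      have hc2 : 2 * (c / 2) = c := by field_simp
      linear_combination (2 * 2 * s - (A + B)) * hs' - 2 * 2 * (2 * (c / 2) + c) * hc2 + 4 * hc
    have huv' : (s + c / 2) * (s - c / 2) ≠ 0 := by
      intro h0; rw [h0, mul_zero] at huv
      exact right_ne_zero_of_mul hu (pow_eq_zero_iff two_ne_zero |>.mp huv.symm)
    obtain ⟨x, hx, hx'⟩ := exists_nonsquare_on_curve h2 (left_ne_zero_of_mul huv')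
      (right_ne_zero_of_mul huv') hds
    obtain ⟨X, Y, hX, hdX, hY⟩ := exists_padic_point_of_zmod hp (α := A + B)
      (β := A * B) (d := d) (by
        intro h'
        have h' : (p : ℤ) ∣ (A - B) ^ 2 := by convert h' using 1; ring
        exact h (((Nat.prime_iff_prime_int.mp (Fact.out : p.Prime)).dvd_of_dvd_pow h').mul_left _))
      hds hx (by
        convert hx' using 2
        have e1 : s + c / 2 - (s - c / 2) = c := by field_simp; ring
        rw [e1]; push_cast
        linear_combination x * hs' + hc)
    refine Or.inr (Or.inl ⟨X, Y, hX, hdX, ?_⟩)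
    rw [hY]; push_cast; ring
  · refine Or.inr (Or.inr ?_)
    have := isSquare_padic_of_zmod hp (n := d * (A * B)) ?_ ?_
    · exact_mod_cast this
    · intro h'
      rcases (Nat.prime_iff_prime_int.mp (Fact.out : p.Prime)).dvd_or_dvd h' with h' | h'
      exacts [hd h', h (h'.mul_right _)]
    · push_cast
      exact isSquare_mul_of_not_isSquare hds hAB

end GoodReduction

/-! ### Square classes of `x`-coordinates -/

lemma exists_squarefree_mul_sq {X : ℚ} (hX : X ≠ 0) :
    ∃ d M e : ℤ, Squarefree d ∧ IsCoprime M e ∧ M ≠ 0 ∧ e ≠ 0 ∧ X = d * M ^ 2 / e ^ 2 := by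
  -- Numerator times denominator has the same square class as `|X|`; its squarefree part is `a`.
  obtain ⟨a, b, hab, ha⟩ := Nat.sq_mul_squarefree (X.num.natAbs * X.den)
  have hn : X.num.natAbs ≠ 0 := by simpa using hX
  have hb : b ≠ 0 := by
    rintro rfl
    simp [hn] at hab
  set q : ℚ := b / X.den with hq
  have hq0 : q ≠ 0 := by rw [hq]; positivity
  have hXq : |X| = a * q ^ 2 := by
    rw [hq]
    have h1 : |X| = X.num.natAbs / X.den := by
      conv_lhs => rw [← Rat.num_div_den X]
      rw [abs_div, Nat.abs_cast, Nat.cast_natAbs, Int.cast_abs]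
    have h2 : (b : ℚ) ^ 2 * a = X.num.natAbs * X.den := by exact_mod_cast hab
    have h3 : (X.den : ℚ) ≠ 0 := by simp
    rw [h1]; field_simp; linear_combination -h2
  have hqq : q ^ 2 = q.num ^ 2 / q.den ^ 2 := by
    conv_lhs => rw [← Rat.num_div_den q]
    rw [div_pow]
  have hcop : IsCoprime q.num q.den := Int.isCoprime_iff_nat_coprime.mpr q.reduced
  rcases lt_or_gt_of_ne hX with h | h
  · refine ⟨-a, q.num, q.den, Int.squarefree_natAbs.mp (by simpa using ha), hcop, by simpa using hq0,
      by simp, ?_⟩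
    rw [abs_of_neg h, hqq] at hXq
    push_cast
    linear_combination -hXq
  · refine ⟨a, q.num, q.den, Int.squarefree_natCast.mpr ha, hcop, by simpa using hq0,
      by simp, ?_⟩
    rw [abs_of_pos h, hqq] at hXq
    push_cast
    linear_combination hXq

lemma exists_int_sq_of_point {a b d M e : ℤ} {X Y : ℚ} (hM : M ≠ 0) (he : e ≠ 0)
    (hX : X = d * M ^ 2 / e ^ 2) (hXY : Y ^ 2 = X * (X ^ 2 + a * X + b)) :
    ∃ K : ℤ, K ^ 2 = d * (d ^ 2 * M ^ 4 + a * d * M ^ 2 * e ^ 2 + b * e ^ 4) := by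
  have hM' : (M : ℚ) ≠ 0 := by exact_mod_cast hM
  have he' : (e : ℚ) ≠ 0 := by exact_mod_cast he
  have h : IsSquare ((d * (d ^ 2 * M ^ 4 + a * d * M ^ 2 * e ^ 2 + b * e ^ 4) : ℤ) : ℚ) := by
    refine ⟨Y * e ^ 3 / M, ?_⟩
    rw [← sq, div_pow, mul_pow, hXY, hX]
    push_cast; field_simp
  rw [Rat.isSquare_intCast_iff] at h
  obtain ⟨K, hK⟩ := h
  exact ⟨K, by rw [sq, ← hK]⟩

/-- Bounds the support of `d`. Comparing powers of `p`, `p ∤ b` would force `p ∣ e` and then, after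
dividing out, `p ∣ M`, against coprimality. -/
lemma dvd_of_dvd_squarefree {a b d M e K : ℤ} (hd : Squarefree d) (hMe : IsCoprime M e)
    (hK : K ^ 2 = d * (d ^ 2 * M ^ 4 + a * d * M ^ 2 * e ^ 2 + b * e ^ 4))
    {p : ℤ} (hp : Prime p) (hpd : p ∣ d) : p ∣ b := by
  obtain ⟨d', rfl⟩ := hpd
  have hp0 := hp.ne_zero
  have hd' : ¬ p ∣ d' := by
    rintro ⟨k, rfl⟩
    exact hp.not_isUnit (hd p ⟨k, by ring⟩)
  obtain ⟨K, rfl⟩ : p ∣ K := hp.dvd_of_dvd_pow (n := 2) ⟨_, hK.trans (mul_assoc _ _ _)⟩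
  have h1 : p * K ^ 2 = d' * (p ^ 2 * d' ^ 2 * M ^ 4 + a * p * d' * M ^ 2 * e ^ 2 + b * e ^ 4) :=
    mul_left_cancel₀ hp0 (by linear_combination hK)
  have h2 : p ∣ d' * (b * e ^ 4) :=
    ⟨K ^ 2 - d' * (p * d' ^ 2 * M ^ 4 + a * d' * M ^ 2 * e ^ 2), by linear_combination -h1⟩
  rcases hp.dvd_or_dvd ((hp.dvd_or_dvd h2).resolve_left hd') with h | h
  · exact h
  · exfalso
    have hpe := hp.dvd_of_dvd_pow h
    have hpM : ¬ p ∣ M := fun hpM => hp.not_isUnit (hMe.isUnit_of_dvd' hpM hpe)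
    obtain ⟨e, rfl⟩ := hpe
    have h3 : K ^ 2 = p * (d' ^ 3 * M ^ 4 + a * p * d' ^ 2 * M ^ 2 * e ^ 2 +
        d' * b * p ^ 2 * e ^ 4) := mul_left_cancel₀ hp0 (by linear_combination h1)
    obtain ⟨K, rfl⟩ : p ∣ K := hp.dvd_of_dvd_pow (n := 2) ⟨_, h3⟩
    have h4 : p * K ^ 2 = d' ^ 3 * M ^ 4 + a * p * d' ^ 2 * M ^ 2 * e ^ 2 +
        d' * b * p ^ 2 * e ^ 4 := mul_left_cancel₀ hp0 (by linear_combination h3)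
    have h5 : p ∣ d' ^ 3 * M ^ 4 :=
      ⟨K ^ 2 - a * d' ^ 2 * M ^ 2 * e ^ 2 - d' * b * p * e ^ 4, by linear_combination -h4⟩
    rcases hp.dvd_or_dvd h5 with h | h
    · exact hd' (hp.dvd_of_dvd_pow h)
    · exact hpM (hp.dvd_of_dvd_pow h)

/-! ### Congruence obstructions at 2 -/

lemma sq_ne_eight_mul_odd {K z : ℤ} (hz : Odd z) : K ^ 2 ≠ 8 * z := by
  intro h
  obtain ⟨k, rfl⟩ : (2 : ℤ) ∣ K := Int.prime_two.dvd_of_dvd_pow (n := 2) ⟨4 * z, by rw [h]; ring⟩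
  have h1 : k ^ 2 = 2 * z := by linarith
  obtain ⟨l, rfl⟩ : (2 : ℤ) ∣ k := Int.prime_two.dvd_of_dvd_pow (n := 2) ⟨z, h1⟩
  obtain ⟨w, rfl⟩ := hz
  have : 2 * l ^ 2 = 2 * w + 1 := by linarith
  omega

lemma intCast_zmod_eight_sq {M : ℤ} (h : Odd M) : (M : ZMod 8) ^ 2 = 1 := by
  obtain ⟨k, rfl⟩ := h
  push_cast
  generalize (k : ZMod 8) = x
  revert x; decide

lemma four_mul_intCast_zmod_eight {M : ℤ} (h : Odd M) : 4 * (M : ZMod 8) = 4 := by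
  obtain ⟨k, rfl⟩ := h
  push_cast
  generalize (k : ZMod 8) = x
  revert x; decide

lemma not_even_and_even {M e : ℤ} (h : IsCoprime M e) (hM : Even M) (he : Even e) : False := by
  have := h.isUnit_of_dvd' hM.two_dvd he.two_dvd
  exact absurd this (by decide)

/-- This is the torsor on the isogenous twist for an even squarefree part `2 d`. If `M` and `e` have
opposite parity, the right side has 2-adic valuation exactly 3. If both are odd, the bracket is `6
mod 8`, and dividing by 16 leaves `d` times a number `≡ 3 mod 4`, which is not a square. -/
lemma two_adic_obstruction {d v c M e K : ℤ} (hd : d % 4 = 1) (hv : Odd v) (hc : Odd c)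
    (hMe : IsCoprime M e)
    (hK : K ^ 2 = 8 * (d * (d ^ 2 * M ^ 4 - 4 * v * d * M ^ 2 * e ^ 2 + c ^ 2 * e ^ 4))) :
    False := by
  have hdo : Odd d := Int.odd_iff.mpr (by omega)
  rcases Int.even_or_odd M with hM | hM <;> rcases Int.even_or_odd e with he | he
  · exact not_even_and_even hMe hM he
  · refine sq_ne_eight_mul_odd ?_ hK
    exact hdo.mul ((((hM.pow_of_ne_zero four_ne_zero).mul_left _).sub
      (((by decide : Even (4 : ℤ)).mul_right _).mul_right _ |>.mul_right _ |>.mul_right _)).add_odd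
      (hc.pow.mul he.pow))
  · refine sq_ne_eight_mul_odd ?_ hK
    exact hdo.mul (((hdo.pow.mul hM.pow).sub_even
      (((by decide : Even (4 : ℤ)).mul_right _).mul_right _ |>.mul_right _ |>.mul_right _)).add_even
      ((he.pow_of_ne_zero four_ne_zero).mul_left _))
  · have h8 : ((d ^ 2 * M ^ 4 - 4 * v * d * M ^ 2 * e ^ 2 + c ^ 2 * e ^ 4 : ℤ) : ZMod 8) = (6 : ℤ) := by
      have h1 := intCast_zmod_eight_sq hM
      have h2 := intCast_zmod_eight_sq he
      have h3 := intCast_zmod_eight_sq hdo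
      have h4 := intCast_zmod_eight_sq hc
      have h5 := four_mul_intCast_zmod_eight (hv.mul hdo)
      push_cast at h5 ⊢
      rw [show (M : ZMod 8) ^ 4 = (M ^ 2) ^ 2 by ring, show (e : ZMod 8) ^ 4 = (e ^ 2) ^ 2 by ring,
        show 4 * (v : ZMod 8) * d = 4 * (v * d) by ring, h1, h2, h3, h4, h5]
      decide
    rw [ZMod.intCast_eq_intCast_iff_dvd_sub] at h8
    obtain ⟨k, hk⟩ := h8
    set q := d ^ 2 * M ^ 4 - 4 * v * d * M ^ 2 * e ^ 2 + c ^ 2 * e ^ 4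
    have hq : q = 2 * (4 * (-k) + 3) := by push_cast at hk; linarith
    rw [hq] at hK
    have h4 : (4 : ℤ) ^ 2 ∣ K ^ 2 := ⟨d * (4 * -k + 3), by rw [hK]; ring⟩
    obtain ⟨L, rfl⟩ := (Int.pow_dvd_pow_iff two_ne_zero).mp h4
    obtain ⟨m, hm⟩ : ∃ m, d = 4 * m + 1 := ⟨d / 4, by omega⟩
    have hL : L ^ 2 = 4 * (m * (4 * -k + 3) - k) + 3 := by
      rw [hm] at hK; linarith
    rcases Int.even_or_odd L with h | h
    · obtain ⟨l, rfl⟩ := h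
      have : 4 * l ^ 2 = 4 * (m * (4 * -k + 3) - k) + 3 := by rw [← hL]; ring
      omega
    · have := Int.sq_mod_four_eq_one_of_odd h
      omega

/-- Excludes the class `-B`. If one of `M, e` is even, the right side is `7` or `5 mod 8`; if both
are odd, the factors are `4` and `2 mod 8`, giving valuation exactly 3. -/
lemma not_isSquare_two_adic {A B r M e K : ℤ} (hA : A ≡ 1 [ZMOD 8]) (hB : B ≡ 3 [ZMOD 8])
    (hr : r ≡ 7 [ZMOD 8]) (hMe : IsCoprime M e)
    (hK : K ^ 2 = -(B * M ^ 2 - A * r * e ^ 2) * (M ^ 2 - r * e ^ 2)) : False := by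
  have hA' : (A : ZMod 8) = 1 := by simpa using (ZMod.intCast_eq_intCast_iff A 1 8).mpr hA
  have hB' : (B : ZMod 8) = 3 := by simpa using (ZMod.intCast_eq_intCast_iff B 3 8).mpr hB
  have hr' : (r : ZMod 8) = 7 := by simpa using (ZMod.intCast_eq_intCast_iff r 7 8).mpr hr
  have h8 := congrArg (fun x : ℤ => (x : ZMod 8)) hK
  push_cast at h8
  rw [hA', hB', hr'] at h8
  rcases Int.even_or_odd M with hM | hM <;> rcases Int.even_or_odd e with he | he
  · exact not_even_and_even hMe hM he
  · rw [intCast_zmod_eight_sq he] at h8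
    obtain ⟨m, rfl⟩ := hM
    push_cast at h8
    revert h8
    generalize (m : ZMod 8) = x
    generalize (K : ZMod 8) = y
    revert x y; decide
  · rw [intCast_zmod_eight_sq hM] at h8
    obtain ⟨m, rfl⟩ := he
    push_cast at h8
    revert h8
    generalize (m : ZMod 8) = x
    generalize (K : ZMod 8) = y
    revert x y; decide
  · have h1 : ((B * M ^ 2 - A * r * e ^ 2 : ℤ) : ZMod 8) = (4 : ℤ) := by
      push_cast
      rw [intCast_zmod_eight_sq hM, intCast_zmod_eight_sq he, hA', hB', hr']; decide
    have h2 : ((M ^ 2 - r * e ^ 2 : ℤ) : ZMod 8) = (2 : ℤ) := by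
      push_cast
      rw [intCast_zmod_eight_sq hM, intCast_zmod_eight_sq he, hr']; decide
    rw [ZMod.intCast_eq_intCast_iff_dvd_sub] at h1 h2
    obtain ⟨k, hk⟩ := h1
    obtain ⟨l, hl⟩ := h2
    refine sq_ne_eight_mul_odd (K := K) (z := -(1 - 2 * k) * (1 - 4 * l)) ?_ ?_
    · refine (Odd.neg ⟨-k, by ring⟩).mul ⟨-(2 * l), by ring⟩
    · rw [hK]
      push_cast at hk hl
      rw [show B * M ^ 2 - A * r * e ^ 2 = 4 - 8 * k by linarith,
        show M ^ 2 - r * e ^ 2 = 2 - 8 * l by linarith]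
      ring

/-! ### The descent on the twist -/

lemma not_isSquare_of_legendreSym {r : ℕ} [Fact r.Prime] {z : ℤ} (h : legendreSym r z = -1) :
    ¬ IsSquare (z : ℚ) := by
  rw [Rat.isSquare_intCast_iff]
  intro h'
  exact (legendreSym.eq_neg_one_iff r).mp h (by exact_mod_cast h'.map (Int.castRingHom (ZMod r)))

/-- The congruence conditions on `A`, `B` and the twisting prime `r`. -/
structure AdmissibleTwist (A B : ℤ) (r : ℕ) : Prop where
  hA : A ≡ 1 [ZMOD 8]
  hB : B ≡ 3 [ZMOD 8]
  prime : r.Prime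
  cop : IsCoprime (r : ℤ) (A * B * (A - B))
  hr8 : r ≡ 7 [MOD 8]
  leg : ∀ (p : ℕ) [Fact p.Prime], p ≠ 2 → (p : ℤ) ∣ A * B * (A - B) → legendreSym p (r : ℤ) = 1

section Twist

variable {A B : ℤ} {r : ℕ} (H : AdmissibleTwist A B r)
include H

namespace AdmissibleTwist

lemma emod_A : A % 8 = 1 := by have := H.hA; unfold Int.ModEq at this; omega

lemma emod_B : B % 8 = 3 := by have := H.hB; unfold Int.ModEq at this; omega

lemma emod_r : r % 8 = 7 := H.hr8

lemma ne_zero : A * B * (A - B) ≠ 0 := by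
  have h1 := H.emod_A
  have h2 := H.emod_B
  refine mul_ne_zero (mul_ne_zero ?_ ?_) ?_ <;> omega

lemma prime_int : Prime (r : ℤ) := Nat.prime_iff_prime_int.mp H.prime

lemma not_dvd : ¬ (r : ℤ) ∣ A * B * (A - B) := fun h =>
  H.prime_int.not_isUnit (H.cop.isUnit_of_dvd' dvd_rfl h)

variable [Fact r.Prime]

lemma legendreSym_eq {z : ℤ}
    (h : ∀ p : ℕ, [Fact p.Prime] → (p : ℤ) ∣ z → (p : ℤ) ∣ A * B * (A - B)) :
    (z % 4 = 1 → legendreSym r z = 1) ∧ (z % 4 = 3 → legendreSym r z = -1) := by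
  have hr := H.emod_r
  by_cases hz : z % 2 = 0
  · constructor <;> intro <;> omega
  · refine legendreSym_eq_of_emod_four (by omega) fun p _ hp => H.leg p ?_ (h p hp)
    rintro rfl
    have : (2 : ℤ) ∣ z := hp
    omega

lemma legendreSym_A : legendreSym r A = 1 :=
  (H.legendreSym_eq fun _ _ h => (h.mul_right _).mul_right _).1 (by have := H.emod_A; omega)

lemma legendreSym_B : legendreSym r B = -1 :=
  (H.legendreSym_eq fun _ _ h => (h.mul_left _).mul_right _).2 (by have := H.emod_B; omega)

lemma legendreSym_neg_one : legendreSym r (-1) = -1 :=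
  (H.legendreSym_eq fun p _ h => h.trans ⟨-(A * B * (A - B)), by ring⟩).2 (by norm_num)

lemma legendreSym_two : legendreSym r 2 = 1 := by
  have hr := H.emod_r
  rw [legendreSym.eq_one_iff r]
  · have := (ZMod.exists_sq_eq_two_iff (p := r) (by omega)).mpr (Or.inr hr)
    exact_mod_cast this
  · rw [Ne, ZMod.intCast_zmod_eq_zero_iff_dvd]
    intro h
    have := Nat.le_of_dvd two_pos (by exact_mod_cast h : r ∣ 2)
    omega

omit [Fact r.Prime] in
/-- `r` is a square in `ℚ_p` for odd primes `p` dividing `A B (A - B)`. -/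
lemma isSquare_padic {p : ℕ} [Fact p.Prime] (hp : p ≠ 2) (h : (p : ℤ) ∣ A * B * (A - B)) :
    ∃ ρ : ℚ_[p], ρ ≠ 0 ∧ ρ ^ 2 = r := by
  have hpr : ¬ (p : ℤ) ∣ (r : ℤ) := by
    intro hd
    have : p = r := (Nat.prime_dvd_prime_iff_eq Fact.out H.prime).mp (by exact_mod_cast hd)
    exact H.not_dvd (this ▸ h)
  have := (legendreSym.eq_one_iff p (by rwa [Ne, ZMod.intCast_zmod_eq_zero_iff_dvd])).mp
    (H.leg p hp h)
  obtain ⟨ρ, hρ⟩ := isSquare_padic_of_zmod hp hpr this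
  have hr0 : (r : ℚ_[p]) ≠ 0 := by exact_mod_cast H.prime.ne_zero
  push_cast at hρ
  refine ⟨ρ, ?_, by rw [hρ, sq]⟩
  rintro rfl
  simp [hr0] at hρ

omit [Fact r.Prime] in
lemma isSquare_real : ∃ ρ : ℝ, ρ ≠ 0 ∧ ρ ^ 2 = r := by
  have : (0 : ℝ) < r := by exact_mod_cast H.prime.pos
  exact ⟨√r, (Real.sqrt_pos.mpr this).ne', Real.sq_sqrt this.le⟩

lemma isSquare_padic_self {d : ℤ} (hd : legendreSym r d = 1) : IsSquare (d : ℚ_[r]) := by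
  have hr := H.emod_r
  have hd0 : (d : ZMod r) ≠ 0 := by
    intro h
    rw [(legendreSym.eq_zero_iff r d).mpr h] at hd
    norm_num at hd
  refine isSquare_padic_of_zmod (by omega) ?_ ((legendreSym.eq_one_iff r hd0).mp hd)
  rwa [Ne, ZMod.intCast_zmod_eq_zero_iff_dvd] at hd0

/-- If `r ∣ d`, then dividing out `r` leaves a quadratic form in `M², e²` vanishing mod `r`; its
discriminant is a square times `A B`, which is a nonresidue. -/
lemma not_dvd_of_torsor {d M e K : ℤ} (hd : Squarefree d) (hMe : IsCoprime M e)
    (hK : K ^ 2 = d * (d ^ 2 * M ^ 4 + (-2 * (A + B) * r) * d * M ^ 2 * e ^ 2 +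
      ((A - B) ^ 2 * r ^ 2) * e ^ 4)) : ¬ (r : ℤ) ∣ d := by
  rintro ⟨d, rfl⟩
  have hr := H.prime_int
  have hr0 := hr.ne_zero
  have hrd : ¬ (r : ℤ) ∣ d := by
    rintro ⟨k, rfl⟩
    exact hr.not_isUnit (hd r ⟨k, by ring⟩)
  set Q := d ^ 2 * M ^ 4 - 2 * (A + B) * d * M ^ 2 * e ^ 2 + (A - B) ^ 2 * e ^ 4 with hQ
  obtain ⟨K, rfl⟩ : (r : ℤ) ∣ K := hr.dvd_of_dvd_pow (n := 2)
    ⟨r ^ 2 * d * Q, by rw [hK, hQ]; ring⟩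
  have h1 : K ^ 2 = r * (d * Q) := by
    apply mul_left_cancel₀ (pow_ne_zero 2 hr0)
    rw [hQ]; linear_combination hK
  obtain ⟨K, rfl⟩ : (r : ℤ) ∣ K := hr.dvd_of_dvd_pow (n := 2) ⟨_, h1⟩
  have h2 : (r : ℤ) ∣ d * Q := ⟨K ^ 2, mul_left_cancel₀ hr0 (by linear_combination -h1)⟩
  have h3 := (hr.dvd_or_dvd h2).resolve_left hrd
  rw [← ZMod.intCast_zmod_eq_zero_iff_dvd, hQ] at h3
  push_cast at h3
  have hdz : (d : ZMod r) ≠ 0 := by rwa [Ne, ZMod.intCast_zmod_eq_zero_iff_dvd]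
  by_cases he : (e : ZMod r) = 0
  · rw [he] at h3
    have : (M : ZMod r) = 0 := by simpa [hdz] using h3
    rw [ZMod.intCast_zmod_eq_zero_iff_dvd] at he this
    exact hr.not_isUnit (hMe.isUnit_of_dvd' this he)
  · have h2' : (2 : ZMod r) ≠ 0 := two_ne_zero_zmod (by have := H.emod_r; omega)
    have hsq : IsSquare ((A * B : ℤ) : ZMod r) := by
      -- Completing the square: the form is `(d M² - (A + B) e²)² - 4 A B e⁴`.
      refine ⟨(d * M ^ 2 - (A + B) * e ^ 2) / (2 * e ^ 2), ?_⟩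
      push_cast
      field_simp
      linear_combination -h3
    have hAB : legendreSym r (A * B) = -1 := by
      rw [legendreSym.mul, H.legendreSym_A, H.legendreSym_B]; norm_num
    exact (legendreSym.eq_neg_one_iff r).mp hAB hsq

/-- Mod `r` only the leading term survives: `K² ≡ d³ M⁴`. If `r ∣ M`, dividing by `r²` leaves `K² ≡
d (A - B)² e⁴`, with `r ∤ e`. -/
lemma legendreSym_eq_one_of_torsor {d M e K : ℤ} (hrd : ¬ (r : ℤ) ∣ d) (hMe : IsCoprime M e)
    (hK : K ^ 2 = d * (d ^ 2 * M ^ 4 + (-2 * (A + B) * r) * d * M ^ 2 * e ^ 2 +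
      ((A - B) ^ 2 * r ^ 2) * e ^ 4)) : legendreSym r d = 1 := by
  have hr := H.prime_int
  have hdz : (d : ZMod r) ≠ 0 := by rwa [Ne, ZMod.intCast_zmod_eq_zero_iff_dvd]
  rw [legendreSym.eq_one_iff r hdz]
  by_cases hM : (r : ℤ) ∣ M
  · have he : ¬ (r : ℤ) ∣ e := fun he => hr.not_isUnit (hMe.isUnit_of_dvd' hM he)
    obtain ⟨M, rfl⟩ := hM
    obtain ⟨K, rfl⟩ : (r : ℤ) ∣ K := hr.dvd_of_dvd_pow (n := 2)
      ⟨d * (d ^ 2 * r ^ 3 * M ^ 4 - 2 * (A + B) * r ^ 2 * d * M ^ 2 * e ^ 2 +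
        (A - B) ^ 2 * r * e ^ 4), by rw [hK]; ring⟩
    have h1 : K ^ 2 = d * (d ^ 2 * r ^ 2 * M ^ 4 - 2 * (A + B) * r * d * M ^ 2 * e ^ 2 +
        (A - B) ^ 2 * e ^ 4) := by
      apply mul_left_cancel₀ (pow_ne_zero 2 hr.ne_zero)
      linear_combination hK
    have h2 := congrArg (fun x : ℤ => (x : ZMod r)) h1
    push_cast at h2
    have he' : (e : ZMod r) ≠ 0 := by rwa [Ne, ZMod.intCast_zmod_eq_zero_iff_dvd]
    have hABz : (A - B : ZMod r) ≠ 0 := by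
      have : ((A * B * (A - B) : ℤ) : ZMod r) ≠ 0 := by
        rw [Ne, ZMod.intCast_zmod_eq_zero_iff_dvd]; exact H.not_dvd
      push_cast at this
      exact right_ne_zero_of_mul this
    refine ⟨K / ((A - B) * e ^ 2), ?_⟩
    field_simp
    rw [h2]; simp; ring
  · have hM' : (M : ZMod r) ≠ 0 := by rwa [Ne, ZMod.intCast_zmod_eq_zero_iff_dvd]
    have h2 := congrArg (fun x : ℤ => (x : ZMod r)) hK
    push_cast at h2
    refine ⟨K / (d * M ^ 2), ?_⟩
    field_simp
    rw [h2]; simp; ring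

end AdmissibleTwist

-- Over a field containing `ρ = √r` the twist is untwisted by `(X, Y) ↦ (X/ρ², Y/ρ³)`, which
-- preserves the square class of `X`.
omit H in
lemma locallySolvable_of_twist_point {L : Type*} [Field L] {ρ : L}
    (hρ : ρ ≠ 0) (hr : ρ ^ 2 = r) {d M e : ℤ} {X Y : L} (hX0 : X ≠ 0)
    (hX : X = d * M ^ 2 / e ^ 2)
    (hXY : Y ^ 2 = X * (X ^ 2 + (-2 * (A + B) * r) * X + (A - B) ^ 2 * r ^ 2)) :
    LocallySolvable (A + B : L) (A * B : L) (d : L) := by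
  refine Or.inr (Or.inl ⟨X / ρ ^ 2, Y / ρ ^ 3, by positivity, ⟨d * M / (e * ρ), ?_⟩, ?_⟩)
  · rw [hX]; field_simp
  · rw [← hr] at hXY
    rw [div_pow, hXY]
    field_simp
    ring

/-- The `X`-coordinates of rational points on the twist of `Ê` are squares. -/
theorem isSquare_of_dualCurve_twist_point (hSel : selmerPhi A B = ⊥) {X Y : ℚ} (hX0 : X ≠ 0)
    (hXY : Y ^ 2 = X * (X ^ 2 + (-2 * (A + B) * r) * X + (A - B) ^ 2 * r ^ 2)) : IsSquare X := by
  have : Fact r.Prime := ⟨H.prime⟩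
  have hA8 := H.emod_A
  have hB8 := H.emod_B
  have hr8 := H.emod_r
  obtain ⟨d, M, e, hd, hMe, hM, he, hX⟩ := exists_squarefree_mul_sq hX0
  obtain ⟨K, hK⟩ := exists_int_sq_of_point (a := -2 * (A + B) * r) (b := (A - B) ^ 2 * r ^ 2)
    hM he hX (by rw [hXY]; push_cast; ring)
  have hrd := H.not_dvd_of_torsor hd hMe hK
  have hleg := H.legendreSym_eq_one_of_torsor hrd hMe hK
  have hdvd : ∀ p : ℕ, [Fact p.Prime] → (p : ℤ) ∣ d → (p : ℤ) ∣ A - B := by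
    intro p _ hp
    have hpp := Nat.prime_iff_prime_int.mp (Fact.out : p.Prime)
    rcases hpp.dvd_or_dvd (dvd_of_dvd_squarefree hd hMe hK hpp hp) with h | h
    · exact hpp.dvd_of_dvd_pow h
    · have h := hpp.dvd_of_dvd_pow h
      have : p = r := (Nat.prime_dvd_prime_iff_eq Fact.out H.prime).mp (by exact_mod_cast h)
      exact absurd (this ▸ hp) hrd
  -- For odd `d` this is reciprocity applied to `(d/r) = 1`. For `d = 2 d'`, `(2/r) = 1` gives `d' ≡
  -- 1 mod 4`, and then `two_adic_obstruction` applies, since `A + B ≡ 4` and `A - B ≡ 6 mod 8`.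
  have hd4 : d % 4 = 1 := by
    by_cases h2 : d % 2 = 0
    · exfalso
      obtain ⟨d', rfl⟩ : (2 : ℤ) ∣ d := Int.dvd_of_emod_eq_zero h2
      have hd' : ¬ (2 : ℤ) ∣ d' := by
        rintro ⟨k, rfl⟩
        exact Int.prime_two.not_isUnit (hd 2 ⟨k, by ring⟩)
      have hl := H.legendreSym_eq (z := d') fun p _ hp =>
        (hdvd p (hp.mul_left 2)).mul_left _
      have hd4 : d' % 4 = 1 := by
        by_contra hne
        have := hl.2 (by omega)
        rw [legendreSym.mul, H.legendreSym_two, this] at hleg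
        norm_num at hleg
      obtain ⟨u, hu⟩ : (4 : ℤ) ∣ A + B := by omega
      have hu2 : u % 2 = 1 := by omega
      obtain ⟨c, hc⟩ : (2 : ℤ) ∣ A - B := by omega
      have hc2 : c % 2 = 1 := by omega
      have hro : Odd (r : ℤ) := by
        rw [Int.odd_iff]; omega
      refine two_adic_obstruction (v := u * r) (c := c * r) hd4
        ((Int.odd_iff.mpr hu2).mul hro) ((Int.odd_iff.mpr hc2).mul hro) hMe (K := K) ?_
      rw [hK, hc, hu]; ring
    · by_contra hne
      have := (H.legendreSym_eq (z := d) fun p _ hp => (hdvd p hp).mul_left _).2 (by omega)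
      rw [this] at hleg
      norm_num at hleg
  have hd0 : (d : ℚ) ≠ 0 := by exact_mod_cast hd.ne_zero
  have hsq : IsSquare (d : ℚ) := by
    refine isSquare_of_selmerPhi_eq_bot H.ne_zero hSel hd0 ?_ ?_
    · obtain ⟨ρ, hρ0, hρ⟩ := H.isSquare_real
      have := locallySolvable_of_twist_point hρ0 hρ (X := (X : ℝ)) (Y := (Y : ℝ)) (d := d)
        (M := M) (e := e) (by exact_mod_cast hX0) (by rw [hX]; push_cast; ring)
        (by exact_mod_cast congrArg (fun x : ℚ => (x : ℝ)) hXY)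
      exact_mod_cast this
    · intro p _
      have : LocallySolvable (A + B : ℚ_[p]) (A * B : ℚ_[p]) (d : ℚ_[p]) := by
        by_cases hp2 : p = 2
        · subst hp2
          by_cases hd8 : d % 8 = 1
          · exact Or.inl (isSquare_padic_two hd8)
          · have hd5 : d % 8 = 5 := by omega
            -- For `d ≡ 5 mod 8`, the choice `X = d` works: the cubic at `d` is `5 (1 + 4) ≡ 1 mod
            -- 8`.
            obtain ⟨Y, hY⟩ := isSquare_padic_two
              (n := d * (d ^ 2 - 2 * (A + B) * d + (A - B) ^ 2)) (by
              refine (ZMod.intCast_eq_intCast_iff _ _ 8).mp ?_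
              push_cast
              rw [(ZMod.intCast_eq_intCast_iff A 1 8).mpr H.hA,
                (ZMod.intCast_eq_intCast_iff B 3 8).mpr H.hB,
                (ZMod.intCast_eq_intCast_iff d 5 8).mpr hd5]
              decide)
            refine Or.inr (Or.inl ⟨d, Y, by exact_mod_cast hd.ne_zero, ⟨d, rfl⟩, ?_⟩)
            rw [sq, ← hY]; push_cast; ring
        by_cases hpr : p = r
        · subst hpr
          exact Or.inl (H.isSquare_padic_self hleg)
        by_cases hp : (p : ℤ) ∣ A * B * (A - B)
        · obtain ⟨ρ, hρ0, hρ⟩ := H.isSquare_padic hp2 hp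
          exact locallySolvable_of_twist_point hρ0 hρ (X := (X : ℚ_[p])) (Y := (Y : ℚ_[p]))
            (M := M) (e := e) (by exact_mod_cast hX0) (by rw [hX]; push_cast; ring)
            (by exact_mod_cast congrArg (fun x : ℚ => (x : ℚ_[p])) hXY)
        · exact locallySolvable_of_good hp2 hp fun h => hp ((hdvd p h).mul_left _)
      exact_mod_cast this
  rw [hX, mul_div_assoc, ← div_pow]
  exact hsq.mul (IsSquare.sq _)

/-- A rational point of the twist of `E` whose `x`-coordinate is an `r`-adic unit and square,
up to squares of rationals, has a square `x`-coordinate. -/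
theorem isSquare_of_curve_twist_point [Fact r.Prime]
    (hSel : Nonempty (selmerPhiHat A B ≃+ ZMod 2 × ZMod 2))
    {x y : ℚ} (hx0 : x ≠ 0) (hxy : y ^ 2 = x * (x + A * r) * (x + B * r))
    {z : ℤ} {s : ℚ} (hxz : x = z * s ^ 2) (hz : legendreSym r z = 1) : IsSquare x := by
  obtain ⟨d, M, e, hd, hMe, hM, he, hx⟩ := exists_squarefree_mul_sq hx0
  -- The hypothesis on `z` passes to the squarefree part `d`, because `z d` is a square.
  obtain ⟨hrd, hleg⟩ : ¬ (r : ℤ) ∣ d ∧ legendreSym r d = 1 := by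
    have hs0 : s ≠ 0 := by rintro rfl; simp [hxz] at hx0
    have hsq : IsSquare ((z * d : ℤ) : ℚ) := by
      have he' : (e : ℚ) ≠ 0 := by exact_mod_cast he
      refine ⟨d * M / (e * s), ?_⟩
      have h1 : (z * s ^ 2 : ℚ) = d * M ^ 2 / e ^ 2 := by rw [← hxz, hx]
      push_cast
      field_simp at h1 ⊢
      linear_combination (d : ℚ) * h1
    rw [Rat.isSquare_intCast_iff] at hsq
    obtain ⟨k, hk⟩ := hsq
    have hrz : ¬ (r : ℤ) ∣ z := by
      rw [← ZMod.intCast_zmod_eq_zero_iff_dvd, ← legendreSym.eq_zero_iff, hz]; norm_num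
    have hrp := H.prime_int
    have hrd : ¬ (r : ℤ) ∣ d := by
      rintro ⟨d, rfl⟩
      obtain ⟨k, rfl⟩ : (r : ℤ) ∣ k := hrp.dvd_of_dvd_pow (n := 2)
        ⟨z * d, by linear_combination -hk⟩
      have h1 : (r : ℤ) ∣ z * d :=
        ⟨k * k, mul_left_cancel₀ hrp.ne_zero (by linear_combination hk)⟩
      obtain ⟨d, rfl⟩ := (hrp.dvd_or_dvd h1).resolve_left hrz
      exact hrp.not_isUnit (hd r ⟨d, by ring⟩)
    refine ⟨hrd, ?_⟩
    have h1 : legendreSym r (z * d) = 1 := by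
      rw [legendreSym.eq_one_iff r]
      · exact ⟨k, by exact_mod_cast congrArg (fun x : ℤ => (x : ZMod r)) hk⟩
      · rw [Ne, ZMod.intCast_zmod_eq_zero_iff_dvd]
        exact fun h => (hrp.dvd_or_dvd h).elim hrz hrd
    rwa [legendreSym.mul, hz, one_mul] at h1
  have hA8 := H.emod_A
  have hB8 := H.emod_B
  have hr8 := H.emod_r
  have hA0 : (A : ℚ) ≠ 0 := by
    exact_mod_cast left_ne_zero_of_mul (left_ne_zero_of_mul H.ne_zero)
  have hB0 : (B : ℚ) ≠ 0 := by
    exact_mod_cast right_ne_zero_of_mul (left_ne_zero_of_mul H.ne_zero)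
  obtain ⟨K, hK⟩ := exists_int_sq_of_point (a := (A + B) * r) (b := A * B * r ^ 2)
    hM he hx (by rw [hxy]; push_cast; ring)
  have hdvd : ∀ p : ℕ, [Fact p.Prime] → (p : ℤ) ∣ d → (p : ℤ) ∣ A * B := by
    intro p _ hp
    have hpp := Nat.prime_iff_prime_int.mp (Fact.out : p.Prime)
    rcases hpp.dvd_or_dvd (dvd_of_dvd_squarefree hd hMe hK hpp hp) with h | h
    · exact h
    · have h := hpp.dvd_of_dvd_pow h
      have : p = r := (Nat.prime_dvd_prime_iff_eq Fact.out H.prime).mp (by exact_mod_cast h)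
      exact absurd (this ▸ hp) hrd
  have hd2 : d % 2 = 1 := by
    by_contra h
    have h2 : (2 : ℤ) ∣ A * B := hdvd 2 (by push_cast; omega)
    rcases Int.prime_two.dvd_or_dvd h2 with h | h <;> omega
  have hd0 : (d : ℚ) ≠ 0 := by exact_mod_cast hd.ne_zero
  have hscale : ∀ {L : Type} [Field L] [CharZero L] {ρ : L}, ρ ≠ 0 → ρ ^ 2 = r →
      LocallySolvable (-2 * (A + B) : L) ((A - B) ^ 2 : L) (d : L) := by
    intro L _ _ ρ hρ0 hρ
    have hxL : (x : L) ≠ 0 := by exact_mod_cast hx0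
    have hxL' : (x : L) = d * M ^ 2 / e ^ 2 := by rw [hx]; push_cast; ring
    have hxyL : (y : L) ^ 2 = x * (x + A * r) * (x + B * r) := by
      exact_mod_cast congrArg (fun x : ℚ => (x : L)) hxy
    refine locallySolvable_dual (Or.inr (Or.inl ⟨x / ρ ^ 2, y / ρ ^ 3,
      div_ne_zero hxL (pow_ne_zero _ hρ0), ⟨d * M / (e * ρ), ?_⟩, ?_⟩))
    · rw [hxL']; field_simp
    · rw [← hρ] at hxyL
      rw [div_pow, hxyL]
      field_simp
  have hAB1 : ¬ IsSquare ((A * B : ℤ) : ℚ) := not_isSquare_of_legendreSym (r := r) (by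
    rw [legendreSym.mul, H.legendreSym_A, H.legendreSym_B]; norm_num)
  have hA1 : ¬ IsSquare ((-A : ℤ) : ℚ) := not_isSquare_of_legendreSym (r := r) (by
    rw [neg_eq_neg_one_mul, legendreSym.mul, H.legendreSym_A, H.legendreSym_neg_one]; norm_num)
  have hB1 : ¬ IsSquare ((-B : ℤ) : ℚ) := by
    rw [Rat.isSquare_intCast_iff]
    rintro ⟨k, hk⟩
    have h8 := congrArg (fun x : ℤ => (x : ZMod 8)) hk
    push_cast at h8
    rw [(ZMod.intCast_eq_intCast_iff B 3 8).mpr H.hB] at h8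
    revert h8
    generalize (k : ZMod 8) = z
    revert z; decide
  have key := isSquare_mul_of_selmerPhiHat H.ne_zero hSel (by exact_mod_cast hA1)
    (by exact_mod_cast hB1) (by exact_mod_cast hAB1) hd0 (by
      obtain ⟨ρ, hρ0, hρ⟩ := H.isSquare_real
      exact_mod_cast hscale hρ0 hρ) (by
      intro p _
      have : LocallySolvable (-2 * (A + B) : ℚ_[p]) ((A - B) ^ 2 : ℚ_[p]) (d : ℚ_[p]) := by
        by_cases hp2 : p = 2
        · subst hp2
          have sq8 : ∀ {n : ℤ} (k : ℤ), n ≡ k [ZMOD 8] → d ≡ k [ZMOD 8] → k * k ≡ 1 [ZMOD 8] →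
              IsSquare ((d * n : ℤ) : ℚ_[2]) := fun k h1 h2 h3 =>
            isSquare_padic_two ((h2.mul h1).trans h3)
          have h4 : d % 8 = 1 ∨ d % 8 = 3 ∨ d % 8 = 5 ∨ d % 8 = 7 := by omega
          have hA2 : (A : ℚ_[2]) ≠ 0 := by exact_mod_cast hA0
          have hB2 : (B : ℚ_[2]) ≠ 0 := by exact_mod_cast hB0
          apply locallySolvable_dual
          -- The global classes `1, A B, -B, -A` are `1, 3, 5, 7 mod 8`, so 2-torsion accounts for
          -- every odd `d` at 2.
          rcases h4 with h | h | h | h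
          · exact Or.inl (isSquare_padic_two h)
          · refine Or.inr (Or.inr ?_)
            exact_mod_cast sq8 (n := A * B) 3 (H.hA.mul H.hB) h (by decide)
          · refine Or.inr (Or.inl ⟨-B, 0, neg_ne_zero.mpr hB2, ?_, by ring⟩)
            exact_mod_cast sq8 (n := -B) 5 (H.hB.neg.trans (by decide)) h (by decide)
          · refine Or.inr (Or.inl ⟨-A, 0, neg_ne_zero.mpr hA2, ?_, by ring⟩)
            exact_mod_cast sq8 (n := -A) 7 (H.hA.neg.trans (by decide)) h (by decide)
        by_cases hpr : p = r
        · subst hpr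
          exact Or.inl (H.isSquare_padic_self hleg)
        by_cases hp : (p : ℤ) ∣ A * B * (A - B)
        · obtain ⟨ρ, hρ0, hρ⟩ := H.isSquare_padic hp2 hp
          exact hscale hρ0 hρ
        · exact locallySolvable_dual_of_good hp2 hp fun h => hp ((hdvd p h).mul_right _)
      exact_mod_cast this)
  -- Since `(d/r) = 1` while `A B` and `-A` are nonresidues mod `r`, those two classes are
  -- impossible. However `(-B/r) = 1`, so the class `-B` needs a separate 2-adic argument.
  rcases key with h | h | h | h
  · rw [hx, mul_div_assoc, ← div_pow]
    exact h.mul (IsSquare.sq _)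
  · refine absurd (by exact_mod_cast h : IsSquare ((A * B * d : ℤ) : ℚ))
      (not_isSquare_of_legendreSym (r := r) ?_)
    rw [legendreSym.mul, legendreSym.mul, H.legendreSym_A, H.legendreSym_B, hleg]; norm_num
  · refine absurd (by exact_mod_cast h : IsSquare ((-A * d : ℤ) : ℚ))
      (not_isSquare_of_legendreSym (r := r) ?_)
    rw [neg_eq_neg_one_mul, legendreSym.mul, legendreSym.mul, H.legendreSym_A,
      H.legendreSym_neg_one, hleg]; norm_num
  · exfalso
    obtain ⟨k, hk⟩ := h
    have he' : (e : ℚ) ≠ 0 := by exact_mod_cast he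
    have hM' : (M : ℚ) ≠ 0 := by exact_mod_cast hM
    have hk0 : k ≠ 0 := by
      rintro rfl
      simp [hB0, hd0] at hk
    -- Writing `x = -B t²` turns the curve equation into the statement that `-(B t² - A r) (t² - r)`
    -- is a square.
    set t : ℚ := k * M / (e * B) with ht
    have ht0 : t ≠ 0 := by rw [ht]; positivity
    have hxt : x = -B * t ^ 2 := by
      rw [hx, ht]; field_simp; linear_combination -hk
    have htn : t = t.num / t.den := (Rat.num_div_den t).symm
    have hsq : IsSquare ((-(B * t.num ^ 2 - A * r * (t.den : ℤ) ^ 2) *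
        (t.num ^ 2 - r * (t.den : ℤ) ^ 2) : ℤ) : ℚ) := by
      refine ⟨y / (B * t) * t.den ^ 2, ?_⟩
      have h1 : (t.num : ℚ) = t * t.den := by field_simp at htn ⊢; exact htn.symm
      have h2 : (y / (B * t)) ^ 2 = -(B * t ^ 2 - A * r) * (t ^ 2 - r) := by
        rw [div_pow, hxy, hxt]; field_simp; ring
      push_cast
      rw [h1]
      linear_combination -(t.den : ℚ) ^ 4 * h2
    rw [Rat.isSquare_intCast_iff] at hsq
    obtain ⟨K, hK⟩ := hsq
    exact not_isSquare_two_adic (r := r) (M := t.num) (e := t.den) H.hA H.hB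
      (by have : (r : ℤ) % 8 = 7 := by omega
          exact this)
      (Int.isCoprime_iff_nat_coprime.mpr t.reduced) (K := K) (by rw [sq, ← hK])

end Twist

/-! ### Doubling and halving -/

section Halving

variable {K : Type*} [Field K] [CharZero K] [DecidableEq K] {W : WeierstrassCurve K}

lemma IsTwoTorsionModel.two_nsmul_some (hW : IsTwoTorsionModel W) {x y : K}
    (h : W.toAffine.Nonsingular x y) (hy : y ≠ 0) :
    ∃ y' h', (2 • Affine.Point.some x y h : W.toAffine.Point) =
      .some (((x ^ 2 - W.a₄) / (2 * y)) ^ 2) y' h' := by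
  have he := (hW.nonsingular_iff x y).mp h
  have hneg : y ≠ W.toAffine.negY x y := by
    simp only [Affine.negY, hW.a₁, hW.a₃]
    intro h'
    apply hy
    linear_combination (1 / 2 : K) * h'
  have hX : W.toAffine.addX x x (W.toAffine.slope x x y y) =
      ((x ^ 2 - W.a₄) / (2 * y)) ^ 2 := by
    rw [Affine.slope_of_Y_ne rfl hneg]
    simp only [Affine.addX, Affine.negY, hW.a₁, hW.a₃]
    have : y - (-y - 0 * x - 0) = 2 * y := by ring
    rw [this]
    field_simp
    linear_combination (-4 * (W.a₂ + 2 * x)) * he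
  have h0 := Affine.Point.add_self_of_Y_ne (h₁ := h) hneg
  refine ⟨W.toAffine.addY x x y (W.toAffine.slope x x y y), ?_, ?_⟩
  · rw [← hX]; exact Affine.nonsingular_add h h fun hxy => hneg hxy.2
  · rw [two_nsmul, h0]; simp only [hX]

omit [CharZero K] in
lemma IsTwoTorsionModel.some_add_two_torsion (hW : IsTwoTorsionModel W) {x y t : K}
    (h : W.toAffine.Nonsingular x y) (ht : W.toAffine.Nonsingular t 0) (hxt : x ≠ t) :
    ∃ y' h', (Affine.Point.some x y h : W.toAffine.Point) + .some t 0 ht =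
      .some ((y / (x - t)) ^ 2 - W.a₂ - x - t) y' h' := by
  have hX : W.toAffine.addX x t (W.toAffine.slope x t y 0) =
      (y / (x - t)) ^ 2 - W.a₂ - x - t := by
    rw [Affine.slope_of_X_ne hxt]
    simp [Affine.addX, hW.a₁]
  have h0 := Affine.Point.add_of_X_ne (h₁ := h) (h₂ := ht) hxt
  refine ⟨W.toAffine.addY x t y (W.toAffine.slope x t y 0), ?_, ?_⟩
  · rw [← hX]; exact Affine.nonsingular_add h ht fun hxy => hxt hxy.1
  · rw [h0]; simp only [hX]

/-- If the `x`-coordinate of a point is a square, and those of the points of the isogenous curve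
`Y² = X³ - 2 a X² + (a² - 4 b) X` are squares, then the point is divisible by two. -/
lemma IsTwoTorsionModel.exists_eq_two_nsmul (hW : IsTwoTorsionModel W)
    (hdual : ∀ X Y : K, X ≠ 0 →
      Y ^ 2 = X * (X ^ 2 - 2 * W.a₂ * X + (W.a₂ ^ 2 - 4 * W.a₄)) → IsSquare X)
    {x y : K} (h : W.toAffine.Nonsingular x y) (hx0 : x ≠ 0) (hx : IsSquare x) :
    ∃ P : W.toAffine.Point, Affine.Point.some x y h = 2 • P := by
  obtain ⟨u, rfl⟩ := hx
  have hu : u ≠ 0 := by rintro rfl; simp at hx0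
  have he := (hW.nonsingular_iff _ y).mp h
  -- `(X, 2 u X)` is a preimage of `(u², ±y)` under the dual isogeny. As `X` is a square `w²`, it
  -- has in turn a preimage `(x', w x')` on `W`, and the composite of the two isogenies is doubling.
  set X := W.a₂ + 2 * u ^ 2 + 2 * (y / u) with hX
  have hXX : X * (W.a₂ + 2 * u ^ 2 - 2 * (y / u)) = W.a₂ ^ 2 - 4 * W.a₄ := by
    rw [hX]; field_simp; linear_combination (-4 : K) * he
  have hX0 : X ≠ 0 := by
    intro h0; rw [h0, zero_mul] at hXX; exact hW.disc hXX.symm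
  obtain ⟨w, hw⟩ := hdual X (2 * u * X) hX0 (by
    rw [← hXX, hX]; ring)
  have hw0 : w ≠ 0 := by rintro rfl; exact hX0 (by simpa using hw)
  set x' := (w ^ 2 - W.a₂ + 2 * u * w) / 2 with hx'
  have hxx : x' * ((w ^ 2 - W.a₂ - 2 * u * w) / 2) = W.a₄ := by
    have hq : X ^ 2 - (2 * W.a₂ + 4 * u ^ 2) * X + (W.a₂ ^ 2 - 4 * W.a₄) = 0 := by
      rw [← hXX, hX]; ring
    rw [hw] at hq
    rw [hx']
    linear_combination (1 / 4 : K) * hq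
  have hx'0 : x' ≠ 0 := by
    intro h0; rw [h0, zero_mul] at hxx; exact hW.a₄ hxx.symm
  have hP : W.toAffine.Nonsingular x' (w * x') := by
    rw [hW.nonsingular_iff, ← hxx, hx']; ring
  obtain ⟨y', h', h2⟩ := hW.two_nsmul_some hP (mul_ne_zero hw0 hx'0)
  have hxe : ((x' ^ 2 - W.a₄) / (2 * (w * x'))) ^ 2 = u * u := by
    have : (x' ^ 2 - W.a₄) / (2 * (w * x')) = u := by
      rw [div_eq_iff (mul_ne_zero two_ne_zero (mul_ne_zero hw0 hx'0)), ← hxx, hx']; ring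
    rw [this, sq]
  -- Only `x`-coordinates have been matched, so the halved point is determined up to sign.
  rcases Affine.Point.X_eq_iff (h₁ := h) (h₂ := h') |>.mp hxe.symm with h3 | h3
  · exact ⟨_, h3.trans h2.symm⟩
  · exact ⟨-.some x' (w * x') hP, by rw [h3, smul_neg, h2]⟩

end Halving

/-! ### Heights -/

section Height

/-- The naive multiplicative height of a rational number. -/
def ratHeight (q : ℚ) : ℤ := max |q.num| q.den

lemma one_le_ratHeight (q : ℚ) : 1 ≤ ratHeight q :=
  le_max_of_le_right (by exact_mod_cast q.pos)

lemma finite_setOf_ratHeight_le (B : ℤ) : {q : ℚ | ratHeight q ≤ B}.Finite := by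
  refine Set.Finite.of_finite_image (f := fun q : ℚ => (q.num, (q.den : ℤ)))
    (((Set.finite_Icc (-B) B).prod (Set.finite_Icc (-B) B)).subset ?_) ?_
  · rintro _ ⟨q, hq, rfl⟩
    have h1 := (le_max_left |q.num| (q.den : ℤ)).trans hq
    have h2 := (le_max_right |q.num| (q.den : ℤ)).trans hq
    have h3 : (0 : ℤ) ≤ q.den := by positivity
    exact ⟨abs_le.mp h1, ⟨by linarith, h2⟩⟩
  · intro q _ q' _ h
    simp only [Prod.mk.injEq, Nat.cast_inj] at h
    exact Rat.ext h.1 h.2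

lemma ratHeight_four_mul_le (q : ℚ) : ratHeight (4 * q) ≤ 4 * ratHeight q := by
  obtain ⟨k, h1, h2⟩ := Rat.exists_eq_mul_div_num_and_eq_mul_div_den (4 * q.num) (d := q.den)
    (by simp)
  have hq : ((4 * q.num : ℤ) : ℚ) / (q.den : ℤ) = 4 * q := by
    push_cast; rw [mul_div_assoc, Rat.num_div_den]
  rw [hq] at h1 h2
  have hk : k ≠ 0 := by
    rintro rfl
    simp at h2
  have hk1 : 1 ≤ |k| := Int.one_le_abs hk
  have h3 : |(4 * q).num| ≤ 4 * |q.num| := by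
    have := congrArg abs h1
    rw [abs_mul, abs_mul, abs_of_pos (by norm_num : (0 : ℤ) < 4)] at this
    nlinarith [abs_nonneg (4 * q).num]
  have h4 : ((4 * q).den : ℤ) ≤ q.den := by
    have := congrArg abs h2
    rw [abs_mul, Nat.abs_cast, Nat.abs_cast] at this
    have h0 : (0 : ℤ) ≤ (4 * q).den := by positivity
    nlinarith
  have h5 := le_max_left |q.num| (q.den : ℤ)
  have h6 := le_max_right |q.num| (q.den : ℤ)
  refine max_le ?_ ?_ <;> unfold ratHeight
  · linarith
  · have h0 : (0 : ℤ) ≤ q.den := by positivity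
    linarith

/-- The map `x ↦ (x² + a x + b) / x` has degree 2, and cancellation between `F` and `G` is
controlled: the identities expressing `m³` and `b n³` through `F, G` show that a common factor
divides `b`, and also bound `max(|m|, n)³` by the height of the image. -/
lemma ratHeight_sq_le (a : ℤ) {b : ℤ} (hb : b ≠ 0) {x : ℚ} (hx : x ≠ 0) :
    ratHeight x ^ 2 ≤ (2 + |a| + |b|) * |b| * ratHeight ((x ^ 2 + a * x + b) / x) := by
  set m := x.num with hm
  set n : ℤ := (x.den : ℤ) with hn
  have hn0 : 0 < n := by rw [hn]; exact_mod_cast x.pos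
  have hm0 : m ≠ 0 := by simpa [hm] using hx
  have hmn : IsCoprime m n := Int.isCoprime_iff_nat_coprime.mpr x.reduced
  set F := m ^ 2 + a * m * n + b * n ^ 2 with hF
  set G := m * n with hG
  have hG0 : G ≠ 0 := mul_ne_zero hm0 hn0.ne'
  set q := (x ^ 2 + a * x + b) / x with hq
  have hqFG : (F : ℚ) / G = q := by
    have hxm : x = m / n := by rw [hm, hn]; push_cast; exact (Rat.num_div_den x).symm
    have h1 : (n : ℚ) ≠ 0 := by exact_mod_cast hn0.ne'
    have h2 : (m : ℚ) ≠ 0 := by exact_mod_cast hm0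
    rw [hq, hF, hG, hxm]; push_cast; field_simp
  obtain ⟨k, h1, h2⟩ := Rat.exists_eq_mul_div_num_and_eq_mul_div_den F hG0
  rw [hqFG] at h1 h2
  have hFG1 : m ^ 3 = m * F - (a * m + b * n) * G := by rw [hF, hG]; ring
  have hFG2 : b * n ^ 3 = n * F - (m + a * n) * G := by rw [hF, hG]; ring
  have hkF : k ∣ F := ⟨_, h1⟩
  have hkG : k ∣ G := ⟨_, h2⟩
  have hkb : k ∣ b := by
    have d1 : k ∣ b * m ^ 3 := by
      rw [hFG1]; exact ((hkF.mul_left _).sub (hkG.mul_left _)).mul_left _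
    have d2 : k ∣ b * n ^ 3 := by
      rw [hFG2]; exact (hkF.mul_left _).sub (hkG.mul_left _)
    obtain ⟨u, v, huv⟩ := hmn.pow (m := 3) (n := 3)
    have : b = u * (b * m ^ 3) + v * (b * n ^ 3) := by linear_combination -b * huv
    rw [this]
    exact (d1.mul_left _).add (d2.mul_left _)
  have hkb' : |k| ≤ |b| := Int.le_of_dvd (abs_pos.mpr hb) ((abs_dvd_abs _ _).mpr hkb)
  set N := ratHeight x with hN
  have hNm : |m| ≤ N := le_max_left _ _
  have hNn : |n| ≤ N := by rw [abs_of_pos hn0]; exact le_max_right _ _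
  have hN1 : 1 ≤ N := one_le_ratHeight x
  set h := |b| * ratHeight q with hh
  have hq1 := one_le_ratHeight q
  have hFh : |F| ≤ h := by
    rw [h1, abs_mul, hh]
    exact mul_le_mul hkb' (le_max_left _ _) (abs_nonneg _) (abs_nonneg _)
  have hGh : |G| ≤ h := by
    rw [h2, abs_mul, hh, Nat.abs_cast]
    exact mul_le_mul hkb' (le_max_right _ _) (by positivity) (abs_nonneg _)
  have hh0 : 0 ≤ h := (abs_nonneg _).trans hFh
  have hbd : ∀ s t : ℤ, |s| ≤ N → |t| ≤ (1 + |a| + |b|) * N →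
      |s * F - t * G| ≤ N * ((2 + |a| + |b|) * h) := by
    intro s t hs ht
    calc |s * F - t * G| ≤ |s * F| + |t * G| := abs_sub _ _
      _ = |s| * |F| + |t| * |G| := by rw [abs_mul, abs_mul]
      _ ≤ N * h + (1 + |a| + |b|) * N * h := by gcongr
      _ = _ := by ring
  have e1 : |m| ^ 3 ≤ N * ((2 + |a| + |b|) * h) := by
    rw [← abs_pow, hFG1]
    refine hbd _ _ hNm ?_
    calc |a * m + b * n| ≤ |a| * |m| + |b| * |n| := by
          rw [← abs_mul, ← abs_mul]; exact abs_add_le _ _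
      _ ≤ |a| * N + |b| * N := by gcongr
      _ ≤ _ := by nlinarith
  have e2 : n ^ 3 ≤ N * ((2 + |a| + |b|) * h) := by
    have h0 : n ^ 3 ≤ |b * n ^ 3| := by
      rw [abs_mul, abs_of_pos (pow_pos hn0 3)]
      nlinarith [Int.one_le_abs hb, pow_pos hn0 3]
    refine h0.trans ?_
    rw [hFG2]
    refine hbd _ _ hNn ?_
    calc |m + a * n| ≤ |m| + |a| * |n| := by
          rw [← abs_mul]; exact abs_add_le _ _
      _ ≤ N + |a| * N := by gcongr
      _ ≤ _ := by nlinarith [abs_nonneg b]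
  have e3 : N ^ 3 ≤ N * ((2 + |a| + |b|) * h) := by
    rcases max_choice |m| n with h' | h' <;> (change N = _ at h')
    · rw [← h'] at e1; exact e1
    · rw [← h'] at e2; exact e2
  have : N * N ^ 2 ≤ N * ((2 + |a| + |b|) * h) := by linarith [e3, (by ring : N * N ^ 2 = N ^ 3)]
  have := le_of_mul_le_mul_left this (by linarith)
  rw [hh] at this
  linarith

end Height

/-! ### Points in the image of an infinite chain of doublings are torsion -/

section Torsion

variable {W : WeierstrassCurve ℚ}

/-- Doubling is split into the two isogenies, each of degree 2 on `x`-coordinates, so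
`ratHeight_sq_le` is applied twice; working with the dual model produces `4 x'`, whence the factor
4. -/
lemma IsTwoTorsionModel.exists_ratHeight_pow_four_le (hW : IsTwoTorsionModel W) {a b : ℤ}
    (ha : W.a₂ = a) (hb : W.a₄ = b) :
    ∃ C : ℤ, 1 ≤ C ∧ ∀ (x y x' y' : ℚ) (h : W.toAffine.Nonsingular x y)
      (h' : W.toAffine.Nonsingular x' y'),
      Affine.Point.some x' y' h' = 2 • Affine.Point.some x y h →
        ratHeight x ^ 4 ≤ C * ratHeight x' := by
  have hb0 : b ≠ 0 := by
    have := hW.a₄; rw [hb] at this; exact_mod_cast this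
  have hD0 : a ^ 2 - 4 * b ≠ 0 := by
    have := hW.disc; rw [ha, hb] at this; exact_mod_cast this
  set C₁ := (2 + |a| + |b|) * |b| with hC₁
  set C₂ := (2 + |-2 * a| + |a ^ 2 - 4 * b|) * |a ^ 2 - 4 * b| with hC₂
  have hC₁1 : 1 ≤ C₁ := by
    have := Int.one_le_abs hb0
    nlinarith [abs_nonneg a]
  have hC₂1 : 1 ≤ C₂ := by
    have := Int.one_le_abs hD0
    nlinarith [abs_nonneg (-2 * a)]
  refine ⟨C₁ ^ 2 * (C₂ * 4), ?_, ?_⟩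
  · have := one_le_pow₀ hC₁1 (n := 2)
    nlinarith
  intro x y x' y' h h' hdbl
  have he := (hW.nonsingular_iff x y).mp h
  have hy : y ≠ 0 := by
    rintro rfl
    rw [two_nsmul, hW.add_self] at hdbl
    exact Affine.Point.some_ne_zero _ hdbl
  have hx : x ≠ 0 := by
    rintro rfl
    exact hy (by simpa using he)
  obtain ⟨y'', h'', h2⟩ := hW.two_nsmul_some h hy
  rw [h2, Affine.Point.some.injEq] at hdbl
  have hx' := hdbl.1
  rw [ha, hb] at he
  rw [hb] at hx'
  set s := (x ^ 2 + a * x + b) / x with hs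
  have hsx : s = (y / x) ^ 2 := by
    rw [hs, div_pow, he]; field_simp
  have hs0 : s ≠ 0 := by rw [hsx]; positivity
  have h1 := ratHeight_sq_le a hb0 hx
  have h3 := ratHeight_sq_le (-2 * a) hD0 hs0
  have hx4 : (s ^ 2 + (-2 * a : ℤ) * s + (a ^ 2 - 4 * b : ℤ)) / s = 4 * x' := by
    rw [div_eq_iff hs0, hx']
    have h4 : s ^ 2 + (-2 * a : ℤ) * s + (a ^ 2 - 4 * b : ℤ) = ((x ^ 2 - b) / x) ^ 2 := by
      rw [hs]; push_cast; field_simp; ring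
    rw [h4, hsx]
    field_simp
    ring
  rw [hx4] at h3
  have h5 := ratHeight_four_mul_le x'
  have hHx := one_le_ratHeight x
  have hHs := one_le_ratHeight s
  calc ratHeight x ^ 4 = (ratHeight x ^ 2) ^ 2 := by ring
    _ ≤ (C₁ * ratHeight s) ^ 2 := by gcongr
    _ = C₁ ^ 2 * ratHeight s ^ 2 := by ring
    _ ≤ C₁ ^ 2 * (C₂ * (4 * ratHeight x')) := by
        gcongr
        exact h3.trans (mul_le_mul_of_nonneg_left h5 (by linarith))
    _ = _ := by ring

/-- Each halving roughly takes a fourth root of the height, so heights along the chain are bounded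
and two `x`-coordinates agree. Then `R i = ±R j` and `R i = 2^(j - i) R j` make `R j` torsion, hence
`R 0`, a multiple of it. -/
lemma IsTwoTorsionModel.isOfFinAddOrder_of_chain (hW : IsTwoTorsionModel W) {a b : ℤ}
    (ha : W.a₂ = a) (hb : W.a₄ = b) {R : ℕ → W.toAffine.Point} (hR : ∀ n, R n = 2 • R (n + 1)) :
    IsOfFinAddOrder (R 0) := by
  have hpow : ∀ n i, R i = 2 ^ n • R (i + n) := by
    intro n
    induction n with
    | zero => simp
    | succ n ih => intro i; rw [ih, hR, ← mul_nsmul', pow_succ, add_assoc]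
  have hfin : ∀ n, IsOfFinAddOrder (R n) → IsOfFinAddOrder (R 0) := fun n hn => by
    rw [hpow n 0, zero_add]; exact hn.nsmul
  by_cases h0 : ∃ n, R n = 0
  · obtain ⟨n, hn⟩ := h0
    exact hfin n (hn ▸ IsOfFinAddOrder.zero)
  push Not at h0
  have hsome : ∀ n, ∃ x y h, R n = .some x y h := by
    intro n
    rcases hn : R n with _ | ⟨x, y, h⟩
    · exact absurd hn (h0 n)
    · exact ⟨x, y, h, rfl⟩
  choose x y h hxy using hsome
  obtain ⟨C, hC1, hC⟩ := hW.exists_ratHeight_pow_four_le ha hb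
  have hstep : ∀ n, ratHeight (x (n + 1)) ^ 4 ≤ C * ratHeight (x n) := fun n =>
    hC _ _ _ _ (h (n + 1)) (h n) (by rw [← hxy, ← hxy]; exact hR n)
  -- `D` is self-reproducing: a next height `H > D` would give `H⁴ ≤ C D ≤ D² < H²`.
  set D := max C (ratHeight (x 0)) with hD
  have hbound : ∀ n, ratHeight (x n) ≤ D := by
    intro n
    induction n with
    | zero => exact le_max_right _ _
    | succ n ih =>
      have h1 := hstep n
      have h2 : C ≤ D := le_max_left _ _
      have h3 := one_le_ratHeight (x (n + 1))
      by_contra! hlt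
      have h4 : C * ratHeight (x n) ≤ D * D := by
        have := one_le_ratHeight (x n)
        exact mul_le_mul h2 ih (by linarith) (by linarith)
      have h5 : D * D < ratHeight (x (n + 1)) ^ 2 := by nlinarith
      have h6 : ratHeight (x (n + 1)) ^ 2 ≤ ratHeight (x (n + 1)) ^ 4 :=
        pow_le_pow_right₀ h3 (by norm_num)
      linarith
  have := (finite_setOf_ratHeight_le D).to_subtype
  obtain ⟨i, j, hij, hf⟩ := Finite.exists_ne_map_eq_of_infinite
    (fun n => (⟨x n, hbound n⟩ : {q : ℚ | ratHeight q ≤ D}))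
  replace hf : x i = x j := congrArg Subtype.val hf
  wlog hlt : i < j generalizing i j
  · exact this j i hij.symm hf.symm (lt_of_le_of_ne (not_lt.mp hlt) hij.symm)
  obtain ⟨k, rfl⟩ := Nat.exists_eq_add_of_lt hlt
  have hk := hpow (k + 1) i
  have hk1 : 1 < 2 ^ (k + 1) := Nat.one_lt_two_pow (by omega)
  apply hfin (i + k + 1)
  rw [isOfFinAddOrder_iff_zsmul_eq_zero]
  have hk' : R i = (2 ^ (k + 1) : ℤ) • R (i + k + 1) := by
    rw [hk, ← add_assoc, ← natCast_zsmul]; push_cast; rfl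
  have hk1' : (1 : ℤ) < 2 ^ (k + 1) := by exact_mod_cast hk1
  have hpm : R i = R (i + k + 1) ∨ R i = -R (i + k + 1) := by
    rw [hxy i, hxy (i + k + 1)]
    exact Affine.Point.X_eq_iff.mp hf
  rcases hpm with hpm | hpm
  · refine ⟨2 ^ (k + 1) - 1, by omega, ?_⟩
    rw [sub_zsmul, ← hk', hpm, one_zsmul, add_neg_cancel]
  · refine ⟨2 ^ (k + 1) + 1, by omega, ?_⟩
    rw [add_zsmul, ← hk', hpm, one_zsmul, neg_add_cancel]

/-- The factor 2 on both sides absorbs a 2-torsion translation; the chain is formed by the doubles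
of the iterated choices of `Q`. -/
lemma IsTwoTorsionModel.rank_eq_zero (hW : IsTwoTorsionModel W) {a b : ℤ}
    (ha : W.a₂ = a) (hb : W.a₄ = b)
    (hdiv : ∀ P : W.toAffine.Point, ∃ Q : W.toAffine.Point, 2 • P = 2 • (2 • Q)) :
    Module.rank ℤ W.toAffine.Point = 0 := by
  rw [rank_eq_zero_iff]
  intro P
  choose f hf using hdiv
  have h0 := hW.isOfFinAddOrder_of_chain ha hb (R := fun n => 2 • f^[n] P) (fun n => by
    rw [Function.iterate_succ_apply']; exact hf _)
  rw [isOfFinAddOrder_iff_zsmul_eq_zero] at h0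
  obtain ⟨n, hn, h⟩ := h0
  refine ⟨n * 2, mul_ne_zero hn two_ne_zero, ?_⟩
  rw [mul_smul]
  exact_mod_cast h

end Torsion

/-! ### The twisted curve -/

lemma isTwoTorsionModel_quadraticTwist {K : Type*} [Field K] [CharZero K] {A B d : ℤ}
    (h : A * B * (A - B) ≠ 0) (hd : d ≠ 0) :
    IsTwoTorsionModel (quadraticTwist (curve K A B) d) := by
  have hW := isTwoTorsionModel_curve (K := K) h
  have hd' : (d : K) ≠ 0 := by exact_mod_cast hd
  refine ⟨rfl, rfl, by simp [quadraticTwist, curve], mul_ne_zero hW.a₄ (pow_ne_zero 2 hd'), ?_⟩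
  have h1 : (quadraticTwist (curve K A B) d).a₂ ^ 2 - 4 * (quadraticTwist (curve K A B) d).a₄ =
      ((curve K A B).a₂ ^ 2 - 4 * (curve K A B).a₄) * d ^ 2 := by
    simp only [quadraticTwist]; ring
  rw [h1]
  exact mul_ne_zero hW.disc (pow_ne_zero 2 hd')

/-- Every rational point of the twist can be translated by a 2-torsion point so as to have a
square `x`-coordinate. -/
lemma AdmissibleTwist.exists_add_two_torsion {A B : ℤ} {r : ℕ} (H : AdmissibleTwist A B r)
    (hSel : Nonempty (selmerPhiHat A B ≃+ ZMod 2 × ZMod 2)) {W : WeierstrassCurve ℚ}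
    (hW : IsTwoTorsionModel W) (ha : W.a₂ = (A + B) * r) (hb : W.a₄ = A * B * r ^ 2) {x y : ℚ}
    (h : W.toAffine.Nonsingular x y) (hy : y ≠ 0) :
    ∃ T : W.toAffine.Point, 2 • T = 0 ∧
      ∃ x' y' h', .some x y h + T = .some x' y' h' ∧ x' ≠ 0 ∧ IsSquare x' := by
  have hrp : Fact r.Prime := ⟨H.prime⟩
  have hr0 : (r : ℚ) ≠ 0 := by exact_mod_cast H.prime.ne_zero
  have hA0 : (A : ℚ) ≠ 0 := by
    exact_mod_cast left_ne_zero_of_mul (left_ne_zero_of_mul H.ne_zero)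
  have hB0 : (B : ℚ) ≠ 0 := by
    exact_mod_cast right_ne_zero_of_mul (left_ne_zero_of_mul H.ne_zero)
  have hcubic : ∀ x y, W.toAffine.Nonsingular x y ↔ y ^ 2 = x * (x + A * r) * (x + B * r) := by
    intro x y
    rw [hW.nonsingular_iff, ha, hb]
    constructor <;> intro h <;> rw [h] <;> ring
  have he := (hcubic x y).mp h
  have hy2 : y ^ 2 ≠ 0 := pow_ne_zero 2 hy
  rw [he] at hy2
  have hx0 : x ≠ 0 := left_ne_zero_of_mul (left_ne_zero_of_mul hy2)
  have hxA : x + A * r ≠ 0 := right_ne_zero_of_mul (left_ne_zero_of_mul hy2)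
  have hxB : x + B * r ≠ 0 := right_ne_zero_of_mul hy2
  have hfin : ∀ {x' y' : ℚ} {z : ℤ} {s : ℚ}, W.toAffine.Nonsingular x' y' → x' ≠ 0 →
      x' = z * s ^ 2 → legendreSym r z = 1 → IsSquare x' := fun h' h0 hz hl =>
    isSquare_of_curve_twist_point H hSel h0 ((hcubic _ _).mp h') hz hl
  have htrans : ∀ {t : ℚ} (x' : ℚ) {z : ℤ} {s : ℚ} (ht : W.toAffine.Nonsingular t 0), x ≠ t →
      (y / (x - t)) ^ 2 - W.a₂ - x - t = x' → x' ≠ 0 → x' = z * s ^ 2 → legendreSym r z = 1 →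
      ∃ T : W.toAffine.Point, 2 • T = 0 ∧
        ∃ x' y' h', .some x y h + T = .some x' y' h' ∧ x' ≠ 0 ∧ IsSquare x' := by
    intro t x' z s ht hxt hx' h0 hz hl
    obtain ⟨y', h', h2⟩ := hW.some_add_two_torsion h ht hxt
    subst hx'
    exact ⟨.some t 0 ht, by rw [two_nsmul, hW.add_self], _, y', h', h2, h0, hfin h' h0 hz hl⟩
  obtain ⟨d, M, e, hd, hMe, hM, hee, hx⟩ := exists_squarefree_mul_sq hx0
  have hM' : (M : ℚ) ≠ 0 := by exact_mod_cast hM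
  have he' : (e : ℚ) ≠ 0 := by exact_mod_cast hee
  have hd' : (d : ℚ) ≠ 0 := by exact_mod_cast hd.ne_zero
  -- Up to squares, adding `(0, 0)`, `(-A r, 0)`, `(-B r, 0)` multiplies the class of `x` by `A B`,
  -- `-A r`, `-B r`. The last two remove a factor `r` from `d`; since `(-B/r) = 1` and `(A B/r) =
  -- (-A/r) = -1`, exactly one of the four translations yields a unit class with symbol 1.
  by_cases hrd : (r : ℤ) ∣ d
  · obtain ⟨δ, rfl⟩ := hrd
    have hrδ : ((δ : ℤ) : ZMod r) ≠ 0 := by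
      rw [Ne, ZMod.intCast_zmod_eq_zero_iff_dvd]
      rintro ⟨k, rfl⟩
      exact H.prime_int.not_isUnit (hd r ⟨k, by ring⟩)
    push_cast at hx hd'
    have hδ : (δ : ℚ) ≠ 0 := right_ne_zero_of_mul hd'
    rcases legendreSym.eq_one_or_neg_one r hrδ with hl | hl
    · refine htrans (t := -(B * r)) (-(B * r) * (x + A * r) / (x + B * r))
        (z := -1 * B * δ) (s := y * e / (δ * M * (x + B * r))) ?_ ?_ ?_ ?_ ?_ ?_
      · rw [hcubic]; ring
      · intro h'; exact hxB (by rw [h']; ring)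
      · have h1 : (y / (x + B * r)) ^ 2 = x * (x + A * r) / (x + B * r) := by
          rw [div_pow, he, div_eq_div_iff (pow_ne_zero 2 hxB) hxB]; ring
        rw [sub_neg_eq_add x, h1, ha, eq_div_iff hxB]
        linear_combination div_mul_cancel₀ (x * (x + A * r)) hxB
      · exact div_ne_zero (mul_ne_zero (neg_ne_zero.mpr (mul_ne_zero hB0 hr0)) hxA) hxB
      · have h1 : x * e ^ 2 = r * δ * M ^ 2 := by rw [hx]; field_simp
        rw [div_pow, mul_pow, he]
        push_cast
        field_simp
        linear_combination (x + A * r) * h1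
      · rw [legendreSym.mul, legendreSym.mul, H.legendreSym_neg_one, H.legendreSym_B, hl]; norm_num
    · refine htrans (t := -(A * r)) (-(A * r) * (x + B * r) / (x + A * r))
        (z := -1 * A * δ) (s := y * e / (δ * M * (x + A * r))) ?_ ?_ ?_ ?_ ?_ ?_
      · rw [hcubic]; ring
      · intro h'; exact hxA (by rw [h']; ring)
      · have h1 : (y / (x + A * r)) ^ 2 = x * (x + B * r) / (x + A * r) := by
          rw [div_pow, he, div_eq_div_iff (pow_ne_zero 2 hxA) hxA]; ring
        rw [sub_neg_eq_add x, h1, ha, eq_div_iff hxA]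
        linear_combination div_mul_cancel₀ (x * (x + B * r)) hxA
      · exact div_ne_zero (mul_ne_zero (neg_ne_zero.mpr (mul_ne_zero hA0 hr0)) hxB) hxA
      · have h1 : x * e ^ 2 = r * δ * M ^ 2 := by rw [hx]; field_simp
        rw [div_pow, mul_pow, he]
        push_cast
        field_simp
        linear_combination (x + B * r) * h1
      · rw [legendreSym.mul, legendreSym.mul, H.legendreSym_neg_one, H.legendreSym_A, hl]; norm_num
  · rw [← ZMod.intCast_zmod_eq_zero_iff_dvd] at hrd
    rcases legendreSym.eq_one_or_neg_one r hrd with hl | hl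
    · refine ⟨0, nsmul_zero _, x, y, h, add_zero _, hx0, hfin h hx0 (z := d) (s := M / e) ?_ hl⟩
      rw [hx]; ring
    · refine htrans (t := 0) (A * B * r ^ 2 / x) (z := A * B * d) (s := r * e / (d * M))
        ?_ hx0 ?_ ?_ ?_ ?_
      · rw [hcubic]; ring
      · rw [sub_zero, div_pow, he, ha]; field_simp; ring
      · exact div_ne_zero (mul_ne_zero (mul_ne_zero hA0 hB0) (pow_ne_zero 2 hr0)) hx0
      · rw [hx]; push_cast; field_simp
      · rw [legendreSym.mul, legendreSym.mul, H.legendreSym_A, H.legendreSym_B, hl]; norm_num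

theorem AdmissibleTwist.rank_eq_zero {A B : ℤ} {r : ℕ} (H : AdmissibleTwist A B r)
    (hSel : selmerPhi A B = ⊥) (hSelDual : Nonempty (selmerPhiHat A B ≃+ ZMod 2 × ZMod 2)) :
    Module.rank ℤ (quadraticTwist (curve ℚ A B) (r : ℤ)).toAffine.Point = 0 := by
  have hW := isTwoTorsionModel_quadraticTwist (K := ℚ) H.ne_zero
    (d := r) (by exact_mod_cast H.prime.ne_zero)
  refine hW.rank_eq_zero (a := (A + B) * r) (b := A * B * r ^ 2)
    (by simp [quadraticTwist, curve]) (by simp [quadraticTwist, curve]) fun P => ?_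
  rcases P with _ | ⟨x, y, h⟩
  · exact ⟨0, by rw [nsmul_zero, nsmul_zero]; exact nsmul_zero _⟩
  by_cases hy : y = 0
  · subst hy
    exact ⟨0, by rw [nsmul_zero, nsmul_zero, two_nsmul, hW.add_self]⟩
  obtain ⟨T, hT, x', y', h', hadd, hx0, hsq⟩ := H.exists_add_two_torsion hSelDual hW
    (by simp [quadraticTwist, curve]) (by simp [quadraticTwist, curve]) h hy
  obtain ⟨Q, hQ⟩ := hW.exists_eq_two_nsmul (fun X Y hX hXY =>
    isSquare_of_dualCurve_twist_point H hSel (Y := Y) hX (by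
      rw [hXY]; simp only [quadraticTwist, curve]; push_cast; ring)) h' hx0 hsq
  exact ⟨Q, by rw [← hQ, ← hadd, nsmul_add, hT, add_zero]⟩

end TwoDescent

end

theorem theorem3 (A B : ℤ) (hA : A ≡ 1 [ZMOD 8]) (hB : B ≡ 3 [ZMOD 8])
    (hSel : TwoDescent.selmerPhi A B = ⊥)
    (hSelDual : Nonempty (TwoDescent.selmerPhiHat A B ≃+ ZMod 2 × ZMod 2))
    (r : ℕ) (hr : r.Prime) (hcop : IsCoprime (r : ℤ) (A * B * (A - B)))
    (hr8 : r ≡ 7 [MOD 8])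
    (hleg : ∀ (p : ℕ) [Fact p.Prime], p ≠ 2 → (p : ℤ) ∣ A * B * (A - B) →
      legendreSym p (r : ℤ) = 1) :
    Module.rank ℤ
      (TwoDescent.quadraticTwist (TwoDescent.curve ℚ A B) (r : ℤ)).toAffine.Point = 0 :=
  TwoDescent.AdmissibleTwist.rank_eq_zero ⟨hA, hB, hr, hcop, hr8, hleg⟩ hSel hSelDual
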